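/- **Setting.** Let $n\ge 2$, let $\mathbb P_A$ be the set of Pauli strings on $A\subseteq[n]$, $\chi_P(Q)=(-1)^{P\cdot Q}$ with $P\cdot Q=0$ if $P,Q$ commute and $1$ otherwise, and let $w(P)$ be the weight of $P$. Let $H$ be a known hypergraph on $[n]$ with non-empty hyperedges of size at most $r$ ($r\ge1$), and let $D\ge 5$ be any upper bound on the maximum degree of the graph obtained by replacing each hyperedge by a clique. The unknown Pauli channel is $\mathcal P(\rho)=\sum_{P\in\mathbb P_n}\mu(P)P\rho P$ with $\mu(P)=\exp\big(\sum_{h\in H}\theta^h(P_h)-C\big)$, $C$ being the log-partition function, and $|\theta^h|\le\beta$ for some $\beta>0$. The clique potentials are normalized by $\sum_{Q\in\mathbb P_h}\theta^h(Q)=0$ and, so that $\mu$ determines them on overlapping hyperedges, by $\sum_{Q\in\mathbb P_h:\,Q_{h\cap h'}=q}\theta^h(Q)=0$ for all $h,h'\in H$ with $h\not\subseteq h'$ and all $q\in\mathbb P_{h\cap h'}$. Put $p_0=\mu(\mathbb I)$. For $h\in H$ let $R_h$ be the smallest set that contains $h$ and whose inner boundary is disjoint from $h$ (the inner boundary being the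 vertices of $R_h$ lying in a hyperedge not contained in $R_h$), that is, $R_h=h\cup\bigcup\{h'\in H:h'\cap h\ne\emptyset\}$. Let $\mathbb P_h^{*}$ be the set of $P\in\mathbb P_h$, $P\neq\mathbb I$, such that every hyperedge containing the support of $P$ contains $h$. *Circuits.* In a run with $k\ge 0$ sequential uses of $\mathcal P$, one prepares $|0^n\rangle$, applies a layer $\mathcal C$ of single-qubit Cliffords, the noise channel $\Phi_1$, a Pauli layer $Q^{\rm in}$, $\mathcal P^k$, a Pauli layer $Q^{\rm out}$, the noise channel $\Phi_2$ and $\mathcal C^{-1}$, and measures $x\in\{0,1\}^n$ in the computational basis; all Clifford and Pauli gates are uniform and independent. Here $\Phi_1,\Phi_2$ are unknown quantum channels, the same in all runs, with $$2^{-2n}\,\big|\mathrm{tr}(\Phi_1^*(P)P)\,\mathrm{tr}(\Phi_2^*(P)P)\big|\ge C_{\rm SPAM}>0\qquad\text{for all }h\in H,\ P\in\mathbb P_{R_h}.$$ The run gives, for each $P\in\mathbb P_n$, the value $\Omega_P=3^{w(P)}\langle x|C^\dagger PC|x\rangle\langle 0^n|C^\dagger PC|0^n\rangle\chi_P(Q^{\rm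 in})\chi_P(Q^{\rm out})$. **Theorem.** There are a universal constant $K>0$ and a function $T(r,D)$ such that the following holds for all such $n,r,D,\beta,H$ and all $\varepsilon>0$, $0<\delta<1$, $C_{\rm SPAM}>0$. There is a protocol, depending only on these data and not on $\theta,\Phi_1,\Phi_2$, that performs independent runs of the above circuits, computes from the values $\Omega_P$ of the runs an estimate $\hat\alpha_P$ of each eigenvalue $\alpha_P=2^{-n}\mathrm{tr}(P\mathcal P(P))$, and returns, for every $h\in H$, $$\hat\theta^h=\frac1{4^{|R_h|}}\sum_{P\in\mathbb P_h^{*}}\chi_P\,\langle\chi_P,\log\hat\mu_{R_h}\rangle,\qquad \hat\mu_{R_h}(Q)=\frac1{4^{|R_h|}}\sum_{P\in\mathbb P_{R_h}}\chi_P(Q)\,\hat\alpha_P ,$$ such that, for all $\theta,\Phi_1,\Phi_2$ as above, with probability at least $1-\delta$ one has $\|\hat\theta^h-\theta^h\|_\infty\le\varepsilon$ for all $h\in H$ simultaneously. The number of runs and the total number of queries to $\mathcal P$ are each at most $$K\,\max\Big\{1,\log\frac1{1-p_0}\Big\}\,\frac{e^{\beta rD^{r+1}}\,4^{6rD^{r+1}}}{(\varepsilon\,C_{\rm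 SPAM})^2}\,\log\frac{n^{rD^{r+1}}}{\delta},$$ and each run uses $\mathcal P$ at most $K\max\{1,\log\frac1{1-p_0}\}$ times sequentially. Moreover $\hat\theta^h$ is computed once for each hyperedge, $|H|\le K\,n^{rD^{r+1}}$, and each computation of $\hat\theta^h$ from the $\hat\alpha_P$, $P\in\mathbb P_{R_h}$, takes at most $T(r,D)$ elementary steps (reading an input, rational constants, $+$, $\times$, $\log$), independently of $n$. -/

import Mathlib

namespace PauliLearning

noncomputable section

open Matrix Finset

/-! ### Pauli strings -/

/-- The four single-qubit Pauli labels. -/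
inductive Pauli : Type
  | I | X | Y | Z
  deriving DecidableEq

instance : Fintype Pauli := ⟨{.I, .X, .Y, .Z}, fun p => by cases p <;> simp⟩

/-- The `2 × 2` Pauli matrices. -/
def Pauli.mat : Pauli → Matrix (Fin 2) (Fin 2) ℂ
  | .I => 1
  | .X => !![0, 1; 1, 0]
  | .Y => !![0, -Complex.I; Complex.I, 0]
  | .Z => !![1, 0; 0, -1]

/-- `(-1)^{p.q}` for single-qubit Paulis: `1` if they commute and `-1` otherwise. -/
def Pauli.sign (p q : Pauli) : ℝ :=
  if p = .I ∨ q = .I ∨ p = q then 1 else -1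

theorem Pauli.mat_mul_comm (p q : Pauli) :
    p.mat * q.mat = ((p.sign q : ℝ) : ℂ) • (q.mat * p.mat) := by
  cases p <;> cases q <;> simp [Pauli.mat, Pauli.sign]

/-- The character `χ_P(Q) = (-1)^{P.Q}` on Pauli strings indexed by `ι`. -/
def chi {ι : Type} [Fintype ι] (P Q : ι → Pauli) : ℝ := ∏ i, (P i).sign (Q i)

/-- The Pauli strings on `n` qubits. -/
abbrev PauliString (n : ℕ) : Type := Fin n → Pauli

/-- The all-identity string. -/
def idString (n : ℕ) : PauliString n := fun _ => .I

/-- The weight `w(P)`, the number of non-identity letters. -/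
def weight {n : ℕ} (P : PauliString n) : ℕ := (univ.filter fun i => P i ≠ .I).card

/-- The substring `P_A`. -/
def restrict {n : ℕ} (P : PauliString n) (A : Finset (Fin n)) : A → Pauli := fun i => P i

/-- A Pauli string on the region `A`, viewed as a string on all qubits (identity outside `A`). -/
def extend {n : ℕ} {A : Finset (Fin n)} (P : A → Pauli) : PauliString n :=
  fun i => if hi : i ∈ A then P ⟨i, hi⟩ else .I

/-! ### Operators and channels on `n` qubits -/

/-- Operators on `n` qubits, in the computational basis of bit strings. -/
abbrev Op (n : ℕ) : Type := Matrix (Fin n → Fin 2) (Fin n → Fin 2) ℂ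

/-- The tensor product `⊗ᵢ A i` of single-qubit operators. -/
def tensor {n : ℕ} (A : Fin n → Matrix (Fin 2) (Fin 2) ℂ) : Op n :=
  Matrix.of fun x y => ∏ i, A i (x i) (y i)

/-- The operator of a Pauli string. -/
def pauliOp {n : ℕ} (P : PauliString n) : Op n := tensor fun i => (P i).mat

/-- The map `ρ ↦ A ρ A†`. -/
def conjBy {n : ℕ} (A : Op n) : Op n →ₗ[ℂ] Op n :=
  LinearMap.mulLeft ℂ A ∘ₗ LinearMap.mulRight ℂ Aᴴ

/-- Quantum channels: maps with a Kraus form `ρ ↦ ∑ₖ Aₖ ρ Aₖ†`, where `∑ₖ Aₖ† Aₖ = 1`. -/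
def IsChannel {n : ℕ} (Φ : Op n →ₗ[ℂ] Op n) : Prop :=
  ∃ (m : ℕ) (A : Fin m → Op n), ∑ k, (A k)ᴴ * A k = 1 ∧ Φ = ∑ k, conjBy (A k)

/-- The Pauli channel `ρ ↦ ∑_P μ(P) P ρ P`. -/
def pauliChannel {n : ℕ} (μ : PauliString n → ℝ) : Op n →ₗ[ℂ] Op n :=
  ∑ P, ((μ P : ℝ) : ℂ) • conjBy (pauliOp P)

/-- The Hilbert-Schmidt adjoint `Φ^*`, given by its matrix entries. -/
def hsDual {n : ℕ} (Φ : Op n →ₗ[ℂ] Op n) (A : Op n) : Op n :=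
  Matrix.of fun i j => star (trace (Aᴴ * Φ (Matrix.single i j 1)))

/-- The defining property `⟨Φ^*(A), B⟩ = ⟨A, Φ(B)⟩` for `⟨A, B⟩ = tr(A† B)`. -/
theorem trace_hsDual {n : ℕ} (Φ : Op n →ₗ[ℂ] Op n) (A B : Op n) :
    trace ((hsDual Φ A)ᴴ * B) = trace (Aᴴ * Φ B) := by
  conv_rhs => rw [Matrix.matrix_eq_sum_single B]
  have h : ∀ i j, Φ (Matrix.single i j (B i j)) = B i j • Φ (Matrix.single i j 1) := by
    intro i j
    rw [← map_smul, Matrix.smul_single, smul_eq_mul, mul_one]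
  simp only [map_sum, h, Matrix.mul_sum, Matrix.trace_sum, Matrix.mul_smul, Matrix.trace_smul]
  simp only [Matrix.trace, Matrix.diag, Matrix.mul_apply, hsDual, Matrix.conjTranspose_apply,
    Matrix.of_apply, star_star]
  rw [Finset.sum_comm]
  simp [smul_eq_mul, mul_comm]

/-- The SPAM factor `2^{-2n} |tr(Φ₁^*(P) P) tr(Φ₂^*(P) P)|` of a Pauli string. -/
def spamFactor {n : ℕ} (Φ₁ Φ₂ : Op n →ₗ[ℂ] Op n) (P : PauliString n) : ℝ :=
  ((2 : ℝ) ^ (2 * n))⁻¹ *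
    ‖trace (hsDual Φ₁ (pauliOp P) * pauliOp P) * trace (hsDual Φ₂ (pauliOp P) * pauliOp P)‖

/-! ### The noisy single-qubit Clifford circuits -/

/-- The Hadamard gate. -/
def gateH : Matrix (Fin 2) (Fin 2) ℂ := ((Real.sqrt 2 : ℝ) : ℂ)⁻¹ • !![1, 1; 1, -1]

/-- The phase gate. -/
def gateS : Matrix (Fin 2) (Fin 2) ℂ := !![1, 0; 0, Complex.I]

/-- Labels of the 24 single-qubit Clifford gates (modulo phases): a Pauli followed by one of
six representatives of the Clifford group modulo the Pauli group. -/
abbrev Clifford : Type := Fin 6 × Pauli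

/-- The unitary matrix of a single-qubit Clifford gate. -/
def cliffordMat (c : Clifford) : Matrix (Fin 2) (Fin 2) ℂ :=
  (![1, gateH, gateS, gateH * gateS, gateS * gateH, gateH * gateS * gateH] c.1) * c.2.mat

/-- A layer of single-qubit Clifford gates. -/
def cliffordOp {n : ℕ} (C : Fin n → Clifford) : Op n := tensor fun i => cliffordMat (C i)

/-- The record of one run: the Clifford layer, the two Pauli layers `Q^in`, `Q^out` and the
measured bit string. -/
structure Record (n : ℕ) : Type where
  clifford : Fin n → Clifford
  qin : PauliString n
  qout : PauliString n
  outcome : Fin n → Fin 2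
  deriving DecidableEq, Fintype

/-- The projection `|x⟩⟨x|`. -/
def basisProj {n : ℕ} (x : Fin n → Fin 2) : Op n := Matrix.single x x 1

/-- The state before the last Clifford layer: prepare `|0ⁿ⟩`, apply the Clifford layer `C`, the
preparation noise `Φ₁`, the Pauli layer `Q^in`, `k` uses of the Pauli channel, the Pauli layer
`Q^out` and the measurement noise `Φ₂`. -/
def preMeasurement {n : ℕ} (μ : PauliString n → ℝ) (Φ₁ Φ₂ : Op n →ₗ[ℂ] Op n) (k : ℕ)
    (C : Fin n → Clifford) (Qin Qout : PauliString n) : Op n :=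
  Φ₂ (conjBy (pauliOp Qout) ((pauliChannel μ ^ k)
    (conjBy (pauliOp Qin) (Φ₁ (conjBy (cliffordOp C) (basisProj 0))))))

/-- The probability of the record `ω` in one run with `k` uses of the channel: the Clifford gates
and the Pauli layers are uniform and independent, and at the end the Clifford layer is undone and
the computational basis is measured. -/
def runProb {n : ℕ} (μ : PauliString n → ℝ) (Φ₁ Φ₂ : Op n →ₗ[ℂ] Op n) (k : ℕ)
    (ω : Record n) : ℝ :=
  ((24 : ℝ) ^ n * 4 ^ n * 4 ^ n)⁻¹ *
    (((cliffordOp ω.clifford)ᴴ * preMeasurement μ Φ₁ Φ₂ k ω.clifford ω.qin ω.qout *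
      cliffordOp ω.clifford) ω.outcome ω.outcome).re

/-- `Ω = 3^{w(P)} ⟨x|C†PC|x⟩ ⟨0ⁿ|C†PC|0ⁿ⟩ χ_P(Q^in) χ_P(Q^out)`, computed from the record of
one run. -/
def shadow {n : ℕ} (P : PauliString n) (ω : Record n) : ℝ :=
  let M : Op n := (cliffordOp ω.clifford)ᴴ * pauliOp P * cliffordOp ω.clifford
  3 ^ weight P * (M ω.outcome ω.outcome).re * (M 0 0).re * chi P ω.qin * chi P ω.qout

/-- A protocol on `n` qubits: the number of runs, the number of sequential uses of the unknown
channel in each run, and for every Pauli string `P` the function that turns the values of the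
random variables `Ω` of the runs into an estimate of the eigenvalue `α_P`. -/
structure Protocol (n : ℕ) : Type where
  runs : ℕ
  uses : Fin runs → ℕ
  fit : PauliString n → (Fin runs → ℝ) → ℝ

/-- The estimated eigenvalues `P ↦ α̂_P`. -/
def Protocol.eigenvalues {n : ℕ} (A : Protocol n) (data : Fin A.runs → Record n) :
    PauliString n → ℝ :=
  fun P => A.fit P fun j => shadow P (data j)

/-- The total number of queries to the unknown channel. -/
def Protocol.queries {n : ℕ} (A : Protocol n) : ℕ := ∑ j, A.uses j

open Classical in
/-- The probability that the data of the independent runs satisfy `E`. -/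
def Protocol.prob {n : ℕ} (A : Protocol n) (μ : PauliString n → ℝ)
    (Φ₁ Φ₂ : Op n →ₗ[ℂ] Op n) (E : (Fin A.runs → Record n) → Prop) : ℝ :=
  ∑ data : Fin A.runs → Record n,
    if E data then ∏ j, runProb μ Φ₁ Φ₂ (A.uses j) (data j) else 0

/-! ### Gibbs distributions on a hypergraph -/

/-- A family of clique potentials `θ^h : P_h → ℝ`. -/
abbrev Potentials (n : ℕ) : Type := (h : Finset (Fin n)) → (h → Pauli) → ℝ

/-- The energy `∑_{h ∈ H} θ^h(P_h)`. -/
def energy {n : ℕ} (H : Finset (Finset (Fin n))) (θ : Potentials n) (P : PauliString n) : ℝ :=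
  ∑ h ∈ H, θ h (restrict P h)

/-- The Gibbs distribution `exp(∑_{h ∈ H} θ^h(P_h) - C)`, where `C` is the log-partition
function. -/
def gibbs {n : ℕ} (H : Finset (Finset (Fin n))) (θ : Potentials n) (P : PauliString n) : ℝ :=
  Real.exp (energy H θ P - Real.log (∑ Q, Real.exp (energy H θ Q)))

/-- The graph in which every hyperedge is replaced by a clique. -/
def interactionGraph {n : ℕ} (H : Finset (Finset (Fin n))) : SimpleGraph (Fin n) where
  Adj i j := i ≠ j ∧ ∃ h ∈ H, i ∈ h ∧ j ∈ h
  symm := ⟨fun _ _ ⟨hne, h, hH, hi, hj⟩ => ⟨hne.symm, h, hH, hj, hi⟩⟩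
  loopless := ⟨fun _ h => h.1 rfl⟩

/-- The normalization of the potentials: each `θ^h` has mean zero, and its partial mean over the
letters outside `h'` vanishes for every hyperedge `h'` that does not contain `h`. -/
def Normalized {n : ℕ} (H : Finset (Finset (Fin n))) (θ : Potentials n) : Prop :=
  ∀ h ∈ H, (∑ Q, θ h Q = 0) ∧
    ∀ h' ∈ H, ¬ h ⊆ h' → ∀ q : h → Pauli,
      ∑ Q ∈ univ.filter (fun Q : h → Pauli => ∀ i : h, (i : Fin n) ∈ h' → Q i = q i), θ h Q = 0

/-- The inner boundary of `R`: the vertices of `R` in a hyperedge that leaves `R`. -/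
def innerBoundary {n : ℕ} (H : Finset (Finset (Fin n))) (R : Finset (Fin n)) :
    Finset (Fin n) :=
  R.filter fun v => ∃ h' ∈ H, v ∈ h' ∧ ¬ h' ⊆ R

/-- The region `R_h`: the set `h` with all hyperedges that meet it. -/
def region {n : ℕ} (H : Finset (Finset (Fin n))) (h : Finset (Fin n)) : Finset (Fin n) :=
  h ∪ (H.filter fun h' => ¬ Disjoint h' h).biUnion id

/-- `R_h` is the smallest set that contains `h` away from its inner boundary. -/
theorem region_isLeast {n : ℕ} (H : Finset (Finset (Fin n))) (h : Finset (Fin n)) :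
    IsLeast {R | h ⊆ R ∧ Disjoint h (innerBoundary H R)} (region H h) := by
  refine ⟨⟨subset_union_left, ?_⟩, ?_⟩
  · rw [Finset.disjoint_left]
    intro v hv hb
    obtain ⟨-, h', hH, hv', hn⟩ := Finset.mem_filter.1 hb
    refine hn fun w hw => Finset.mem_union_right _ (Finset.mem_biUnion.2 ⟨h', ?_, hw⟩)
    exact Finset.mem_filter.2 ⟨hH, fun hd => Finset.disjoint_left.1 hd hv' hv⟩
  · rintro R ⟨hR, hd⟩
    refine Finset.union_subset hR fun w hw => ?_
    obtain ⟨h', hh', hw'⟩ := Finset.mem_biUnion.1 hw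
    obtain ⟨hH, hm⟩ := Finset.mem_filter.1 hh'
    obtain ⟨v, hv', hv⟩ := Finset.not_disjoint_iff.1 hm
    by_contra hwR
    exact Finset.disjoint_left.1 hd hv
      (Finset.mem_filter.2 ⟨hR hv, h', hH, hv', fun hs => hwR (hs hw')⟩)

/-! ### The estimator of the potentials -/

/-- The marginal on the region `A`, obtained from (estimated) eigenvalues `a` by the inverse
Fourier transform `μ_A(Q) = 4^{-|A|} ∑_{P ∈ P_A} (-1)^{P.Q} a_P`. -/
def marginalOf {n : ℕ} (a : PauliString n → ℝ) (A : Finset (Fin n)) (Q : A → Pauli) : ℝ :=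
  ((4 : ℝ) ^ A.card)⁻¹ * ∑ P : A → Pauli, chi P Q * a (extend P)

/-- The non-trivial strings on `h` that `θ^h` is responsible for: `h` is the smallest hyperedge
on which the string is supported. -/
def ownModes {n : ℕ} (H : Finset (Finset (Fin n))) (h : Finset (Fin n)) :
    Finset (h → Pauli) :=
  univ.filter fun P => (∃ i, P i ≠ .I) ∧
    ∀ h' ∈ H, (∀ i : h, P i ≠ .I → (i : Fin n) ∈ h') → h ⊆ h'

/-- The local Fourier projection
`θ̂^h = 4^{-|R_h|} ∑_P χ_P ⟨χ_P, log μ̂_{R_h}⟩`, the sum being over the strings `P` of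
`ownModes H h`, and `μ̂_{R_h}` the marginal computed from the eigenvalues `a`. -/
def potentialEstimator {n : ℕ} (H : Finset (Finset (Fin n))) (a : PauliString n → ℝ)
    (h : Finset (Fin n)) (Q : h → Pauli) : ℝ :=
  ((4 : ℝ) ^ (region H h).card)⁻¹ * ∑ P ∈ ownModes H h, chi P Q *
    ∑ Q' : region H h → Pauli,
      chi (restrict (extend P) (region H h)) Q' * Real.log (marginalOf a (region H h) Q')

/-! ### Unit-cost arithmetic programs -/

/-- One step of a straight-line program with inputs indexed by `ι`; each step writes one new
register, and earlier registers are addressed by their number. -/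
inductive Instr (ι : Type) : Type
  | read (i : ι)
  | const (q : ℚ)
  | add (a b : ℕ)
  | mul (a b : ℕ)
  | log (a : ℕ)

/-- The value written by one step. -/
def Instr.eval {ι : Type} (x : ι → ℝ) (regs : List ℝ) : Instr ι → ℝ
  | .read i => x i
  | .const q => (q : ℝ)
  | .add a b => regs.getD a 0 + regs.getD b 0
  | .mul a b => regs.getD a 0 * regs.getD b 0
  | .log a => Real.log (regs.getD a 0)

/-- The registers after running a program; the run time is the length of the program. -/
def runProgram {ι : Type} (x : ι → ℝ) (prog : List (Instr ι)) : List ℝ :=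
  prog.foldl (fun regs s => regs ++ [s.eval x regs]) []

/-- `θ̂^h` can be computed from the eigenvalues of the strings on `R_h` in at most `t` steps. -/
def EstimatorRunsIn {n : ℕ} (H : Finset (Finset (Fin n))) (h : Finset (Fin n)) (t : ℕ) : Prop :=
  ∃ (prog : List (Instr (region H h → Pauli))) (out : (h → Pauli) → ℕ),
    prog.length ≤ t ∧ ∀ (a : PauliString n → ℝ) (Q : h → Pauli),
      (runProgram (fun P => a (extend P)) prog).getD (out Q) 0 = potentialEstimator H a h Q

/-- The rate `max(1, log(1/(1-p₀))) e^{β r D^{r+1}} 4^{6 r D^{r+1}} (ε C_SPAM)^{-2}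
log(n^{r D^{r+1}}/δ)`. -/
def queryRate (n r D : ℕ) (β ε δ Cspam p₀ : ℝ) : ℝ :=
  max 1 (Real.log (1 / (1 - p₀))) *
    (Real.exp (β * (r * D ^ (r + 1) : ℕ)) * 4 ^ (6 * (r * D ^ (r + 1))) / (ε * Cspam) ^ 2) *
    Real.log ((n : ℝ) ^ (r * D ^ (r + 1)) / δ)

end

end PauliLearning

open PauliLearning

namespace PauliLearning

open Matrix Finset

/-! ### Fourier analysis on Pauli strings and exactness of the estimator -/

section Fourier

/-! ### Characters of the Pauli group -/

/-! Exactness. Every hyperedge meeting `h` lies inside `R_h`. Summing out the letters off `R_h`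
therefore leaves the logarithm of the marginal equal to the sum of the potentials meeting `h` plus a
function of the letters off `h` (`exists_log_marginal_eq`). At a string of `ownModes H h`, that
remainder has no Fourier coefficient, because the string is non-trivial inside `h`, and the other
potentials have none by the normalization. The normalization also makes `θ^h` vanish at all other
modes, so the estimator is exact at the true eigenvalues (`potentialEstimator_eigenvalue`).

Stability. Changing the letters on `R_h` changes only the potentials of hyperedges touching `R_h`,
each by at most `2β`. This bounds the marginals below, so the logarithm is Lipschitz there and an
eigenvalue error `eigenvalueAccuracy` suffices. Counting hyperedges in a graph of degree at most `D`
bounds all exponents by `m = r D^(r+1)`.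

Estimation. Averaging over the Pauli layers projects on the mode `P`, and averaging over the
Clifford layer turns preparation and measurement into `P` itself. Hence the mean of `Ω_P` after `k`
uses is a SPAM constant times `α_P ^ k` (`expectation_shadow`). Runs with `k = 0` and `k = 1`
suffice: the SPAM constant cancels in the ratio of the empirical means, and its modulus is at least
`C_SPAM`, so the division is stable. Hoeffding's inequality for variables bounded by `3^|R_h|`, with
a union bound over all `h` and `P`, gives the number of runs. The factor `max 1 (log (1 / (1 -
p₀)))` is only used through being at least `1`.

The claimed rate can fall below one run when `ε` is large. If `β ≤ ε` the answer `0` is already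
accurate, and it is produced without any run by `depolarizingProtocol`. If `C_SPAM > 1` the SPAM
hypothesis fails at the identity string as soon as `H` is non-empty. -/

theorem Pauli.sum_univ {M : Type*} [AddCommMonoid M] (f : Pauli → M) :
    ∑ p, f p = f .I + f .X + f .Y + f .Z := by
  change ∑ p ∈ ({.I, .X, .Y, .Z} : Finset Pauli), f p = _
  simp [add_assoc]

theorem Pauli.card_eq_four : Fintype.card Pauli = 4 := rfl

theorem Pauli.sign_comm (p q : Pauli) : p.sign q = q.sign p := by
  cases p <;> cases q <;> simp [Pauli.sign]

theorem Pauli.sum_sign_mul_sign (q q' : Pauli) :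
    ∑ p : Pauli, p.sign q * p.sign q' = if q = q' then 4 else 0 := by
  rw [Pauli.sum_univ]
  cases q <;> cases q' <;> simp [Pauli.sign] <;> norm_num

/-- Multiplication (up to phase) by a letter that anticommutes with `p` flips the sign: by `Z` if
`p` is `X` or `Y`, by `X` if `p` is `Z`. -/
theorem Pauli.exists_perm_sign_neg {p : Pauli} (hp : p ≠ .I) :
    ∃ e : Equiv.Perm Pauli, ∀ q, p.sign (e q) = -p.sign q := by
  cases p
  · exact absurd rfl hp
  · refine ⟨Equiv.swap .I .Z * Equiv.swap .X .Y, fun q => ?_⟩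
    cases q <;> simp [Pauli.sign, Equiv.swap_apply_def]
  · refine ⟨Equiv.swap .I .Z * Equiv.swap .X .Y, fun q => ?_⟩
    cases q <;> simp [Pauli.sign, Equiv.swap_apply_def]
  · refine ⟨Equiv.swap .I .X * Equiv.swap .Z .Y, fun q => ?_⟩
    cases q <;> simp [Pauli.sign, Equiv.swap_apply_def]

section Characters

variable {ι : Type} [Fintype ι]

theorem chi_comm (P Q : ι → Pauli) : chi P Q = chi Q P :=
  Finset.prod_congr rfl fun _ _ => Pauli.sign_comm _ _

theorem abs_chi (P Q : ι → Pauli) : |chi P Q| = 1 := by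
  rw [chi, Finset.abs_prod]
  refine Finset.prod_eq_one fun i _ => ?_
  unfold Pauli.sign
  split_ifs <;> simp

theorem sum_chi_mul_chi [DecidableEq ι] (Q Q' : ι → Pauli) :
    ∑ P, chi P Q * chi P Q' = if Q = Q' then (4 : ℝ) ^ Fintype.card ι else 0 := by
  simp only [chi, ← Finset.prod_mul_distrib]
  rw [← Fintype.prod_sum fun i (p : Pauli) => p.sign (Q i) * p.sign (Q' i)]
  simp only [Pauli.sum_sign_mul_sign]
  split_ifs with h
  · simp [h]
  · obtain ⟨i, hi⟩ := Function.ne_iff.1 h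
    exact Finset.prod_eq_zero (mem_univ i) (if_neg hi)

theorem sum_chi_mul_sum_chi [DecidableEq ι] (f : (ι → Pauli) → ℝ) (Q : ι → Pauli) :
    ∑ P, chi P Q * ∑ Q', chi P Q' * f Q' = (4 : ℝ) ^ Fintype.card ι * f Q := by
  simp only [Finset.mul_sum]
  rw [Finset.sum_comm]
  simp only [← mul_assoc]
  simp only [← Finset.sum_mul, sum_chi_mul_chi]
  simp

/-- A function that does not depend on the letter at `i` has no Fourier modes at strings that
are non-trivial at `i`. -/
theorem sum_chi_mul_eq_zero [DecidableEq ι] {P : ι → Pauli} {f : (ι → Pauli) → ℝ} (i : ι)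
    (hi : P i ≠ .I) (hf : ∀ Q Q' : ι → Pauli, (∀ j, j ≠ i → Q j = Q' j) → f Q = f Q') :
    ∑ Q, chi P Q * f Q = 0 := by
  obtain ⟨e, he⟩ := Pauli.exists_perm_sign_neg hi
  -- Changing only the letter at `i` flips `χ_P` and fixes `f`, so the sum equals its own negative.
  let σ : (ι → Pauli) ≃ (ι → Pauli) :=
    Equiv.piCongrRight fun j => if j = i then e else Equiv.refl _
  have hchi : ∀ Q, chi P (σ Q) = -chi P Q := by
    intro Q
    simp only [chi]
    rw [← Finset.mul_prod_erase univ _ (mem_univ i),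
      ← Finset.mul_prod_erase univ (fun j => (P j).sign (Q j)) (mem_univ i), ← neg_mul]
    congr 1
    · simp [σ, he]
    · refine Finset.prod_congr rfl fun j hj => ?_
      simp [σ, (Finset.mem_erase.1 hj).1]
  have hfσ : ∀ Q, f (σ Q) = f Q := fun Q => hf _ _ fun j hj => by simp [σ, hj]
  have h := Equiv.sum_comp σ fun Q => chi P Q * f Q
  simp only [hchi, hfσ, neg_mul, Finset.sum_neg_distrib] at h
  linarith

/-- If the partial sums of `f` at fixed letters on `A` vanish, `f` is orthogonal to every function
of the letters on `A`. -/
theorem sum_mul_eq_zero_of_partial_sums [DecidableEq ι] (A : ι → Prop) [DecidablePred A]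
    {f g : (ι → Pauli) → ℝ}
    (hf : ∀ q : ι → Pauli, ∑ Q ∈ univ.filter (fun Q : ι → Pauli => ∀ i, A i → Q i = q i), f Q = 0)
    (hg : ∀ Q Q' : ι → Pauli, (∀ i, A i → Q i = Q' i) → g Q = g Q') :
    ∑ Q, g Q * f Q = 0 := by
  -- The non-empty fibres of `rep` are exactly the sets of strings with prescribed letters on `A`;
  -- on each of them `g` is constant and `f` sums to zero.
  let rep : (ι → Pauli) → ι → Pauli := fun Q i => if A i then Q i else .I
  have hrep : ∀ Q q, rep Q = rep q ↔ ∀ i, A i → Q i = q i := by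
    intro Q q
    constructor
    · intro h i hi
      simpa [rep, hi] using congrFun h i
    · intro h
      funext i
      by_cases hi : A i
      · simp [rep, hi, h i hi]
      · simp [rep, hi]
  rw [← Finset.sum_fiberwise univ rep]
  refine Finset.sum_eq_zero fun t _ => ?_
  by_cases ht : ∃ q, rep q = t
  · obtain ⟨q, rfl⟩ := ht
    simp only [hrep]
    rw [Finset.sum_congr rfl (g := fun Q => g q * f Q)]
    · rw [← Finset.mul_sum, hf, mul_zero]
    · intro Q hQ
      rw [hg Q q (Finset.mem_filter.1 hQ).2]
  · rw [Finset.filter_false_of_mem, Finset.sum_empty]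
    exact fun Q _ h => ht ⟨Q, h⟩

end Characters

/-! ### Substrings -/

variable {n : ℕ}

theorem restrict_extend {A : Finset (Fin n)} (P : A → Pauli) : restrict (extend P) A = P := by
  funext i
  simp [restrict, extend]

theorem chi_restrict {A : Finset (Fin n)} {P : PauliString n} (hP : ∀ i, P i ≠ .I → i ∈ A)
    (S : PauliString n) : chi (restrict P A) (restrict S A) = chi P S := by
  simp only [chi, restrict]
  rw [Finset.prod_coe_sort A fun i => (P i).sign (S i)]
  refine Finset.prod_subset (Finset.subset_univ A) fun i _ hi => ?_
  have : P i = .I := by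
    by_contra h
    exact hi (hP i h)
  simp [Pauli.sign, this]

theorem extend_ne {A : Finset (Fin n)} {P : A → Pauli} {i : Fin n} (h : extend P i ≠ .I) :
    ∃ hi : i ∈ A, P ⟨i, hi⟩ ≠ .I := by
  unfold extend at h
  split_ifs at h with hi
  · exact ⟨hi, h⟩
  · exact absurd rfl h

theorem chi_extend {A : Finset (Fin n)} (P : A → Pauli) (S : PauliString n) :
    chi (extend P) S = chi P (restrict S A) := by
  rw [← chi_restrict (fun i hi => (extend_ne hi).1) S, restrict_extend]

/-- Splitting a string into its letters on `A` and the letters off `A`. -/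
def splitEquiv (A : Finset (Fin n)) :
    PauliString n ≃ (A → Pauli) × ({i // i ∉ A} → Pauli) :=
  Equiv.piEquivPiSubtypeProd (fun i => i ∈ A) fun _ => Pauli

/-- The string with letters `Q` on `A` and letters `T` off `A`. -/
def glue {A : Finset (Fin n)} (Q : A → Pauli) (T : {i // i ∉ A} → Pauli) : PauliString n :=
  (splitEquiv A).symm (Q, T)

theorem glue_apply_mem {A : Finset (Fin n)} (Q : A → Pauli) (T : {i // i ∉ A} → Pauli)
    {i : Fin n} (hi : i ∈ A) : glue Q T i = Q ⟨i, hi⟩ := by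
  simp [glue, splitEquiv, Equiv.piEquivPiSubtypeProd, hi]

theorem glue_apply_notMem {A : Finset (Fin n)} (Q : A → Pauli) (T : {i // i ∉ A} → Pauli)
    {i : Fin n} (hi : i ∉ A) : glue Q T i = T ⟨i, hi⟩ := by
  simp [glue, splitEquiv, Equiv.piEquivPiSubtypeProd, hi]

theorem restrict_glue {A : Finset (Fin n)} (Q : A → Pauli) (T : {i // i ∉ A} → Pauli) :
    restrict (glue Q T) A = Q := by
  funext i
  exact glue_apply_mem Q T i.2

theorem sum_eq_sum_glue (A : Finset (Fin n)) (F : PauliString n → ℝ) :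
    ∑ S, F S = ∑ Q : A → Pauli, ∑ T, F (glue Q T) := by
  rw [← Fintype.sum_prod_type', ← Equiv.sum_comp (splitEquiv A).symm]
  rfl

/-- The uniform distribution restricts to the uniform distribution. This lets Fourier coefficients
on `h`, on `R_h` and on all qubits be compared. -/
theorem mean_restrict (A : Finset (Fin n)) (G : (A → Pauli) → ℝ) :
    ((4 : ℝ) ^ n)⁻¹ * ∑ S : PauliString n, G (restrict S A) =
      ((4 : ℝ) ^ A.card)⁻¹ * ∑ Q, G Q := by
  rw [sum_eq_sum_glue A]
  simp only [restrict_glue, Finset.sum_const, Finset.card_univ, nsmul_eq_mul]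
  rw [← Finset.mul_sum]
  have hc : Fintype.card {i : Fin n // i ∉ A} + A.card = n := by
    rw [Fintype.card_subtype_compl]
    simp only [Fintype.card_fin, Fintype.card_coe]
    exact Nat.sub_add_cancel (by simpa using Finset.card_le_univ A)
  have : ((4 : ℝ) ^ n) = 4 ^ Fintype.card {i : Fin n // i ∉ A} * 4 ^ A.card := by
    rw [← pow_add, hc]
  rw [this]
  simp only [Fintype.card_fun, Pauli.card_eq_four, Nat.cast_pow, Nat.cast_ofNat]
  field_simp

/-! ### Marginals and eigenvalues -/

/-- The eigenvalues `α_P = ∑_S μ(S) χ_P(S)` of the Pauli channel. -/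
noncomputable def eigenvalue (μ : PauliString n → ℝ) (P : PauliString n) : ℝ :=
  ∑ S, μ S * chi P S

/-- Character orthogonality on `A` removes every string whose letters on `A` differ from `Q`; hence
the eigenvalues supported on `A` determine the marginal on `A`. -/
theorem marginalOf_eigenvalue (μ : PauliString n → ℝ) (A : Finset (Fin n)) (Q : A → Pauli) :
    marginalOf (eigenvalue μ) A Q = ∑ T, μ (glue Q T) := by
  unfold marginalOf eigenvalue
  simp only [Finset.mul_sum]
  rw [Finset.sum_comm, sum_eq_sum_glue A]
  have h : ∀ (Q' : A → Pauli) T, ∑ P : A → Pauli,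
      ((4 : ℝ) ^ A.card)⁻¹ * (chi P Q * (μ (glue Q' T) * chi (extend P) (glue Q' T))) =
        if Q = Q' then μ (glue Q' T) else 0 := by
    intro Q' T
    simp only [chi_extend, restrict_glue]
    rw [Finset.sum_congr rfl (g := fun P =>
      ((4 : ℝ) ^ A.card)⁻¹ * μ (glue Q' T) * (chi P Q * chi P Q')) (fun P _ => by ring),
      ← Finset.mul_sum, sum_chi_mul_chi]
    split_ifs
    · simp only [Fintype.card_coe]
      field_simp
    · simp
  simp only [h]
  rw [Finset.sum_comm]
  simp

theorem abs_eigenvalue_le {μ : PauliString n → ℝ} (h0 : ∀ S, 0 ≤ μ S) (h1 : ∑ S, μ S = 1)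
    (P : PauliString n) : |eigenvalue μ P| ≤ 1 := by
  refine (Finset.abs_sum_le_sum_abs _ _).trans (le_of_eq ?_)
  simp only [abs_mul, abs_chi, mul_one, abs_of_nonneg (h0 _), h1]

theorem gibbs_pos (H : Finset (Finset (Fin n))) (θ : Potentials n) (P : PauliString n) :
    0 < gibbs H θ P := Real.exp_pos _

theorem sum_gibbs (H : Finset (Finset (Fin n))) (θ : Potentials n) :
    ∑ P, gibbs H θ P = 1 := by
  have : 0 < ∑ Q : PauliString n, Real.exp (energy H θ Q) :=
    Finset.sum_pos (fun _ _ => Real.exp_pos _) ⟨idString n, mem_univ _⟩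
  simp only [gibbs, Real.exp_sub, Real.exp_log this]
  rw [← Finset.sum_div, div_self this.ne']

theorem subset_region {H : Finset (Finset (Fin n))} {h h' : Finset (Fin n)} (hh' : h' ∈ H)
    (hd : ¬ Disjoint h' h) : h' ⊆ region H h := fun _ hi =>
  Finset.mem_union_right _ (Finset.mem_biUnion.2 ⟨h', Finset.mem_filter.2 ⟨hh', hd⟩, hi⟩)

theorem self_subset_region (H : Finset (Finset (Fin n))) (h : Finset (Fin n)) :
    h ⊆ region H h := Finset.subset_union_left

theorem restrict_congr {P Q : PauliString n} {A : Finset (Fin n)} (h : ∀ i ∈ A, P i = Q i) :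
    restrict P A = restrict Q A := by
  funext i
  exact h i i.2

/-! ### Exactness of the estimator at the true eigenvalues -/

/-- If the support of `P` lies in `h'`, then `h ⊆ h'` because `P` is an own mode, so `h'` is not
contained in `h`. The partial means of `θ^{h'}` at fixed letters on `h` then vanish, while `χ_P`
depends only on those letters. Otherwise `P` is non-trivial at a site off `h'`, which `θ^{h'}` does
not see. -/
theorem sum_chi_own_mode {H : Finset (Finset (Fin n))} {θ : Potentials n} (hθ : Normalized H θ)
    {h h' : Finset (Fin n)} (hh : h ∈ H) (hh' : h' ∈ H) (hne : h' ≠ h) {P : h → Pauli}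
    (hP : P ∈ ownModes H h) :
    ∑ S : PauliString n, chi (extend P) S * θ h' (restrict S h') = 0 := by
  obtain ⟨-, ⟨i, hi⟩, hown⟩ := Finset.mem_filter.1 hP
  by_cases hs : ∀ i : h, P i ≠ .I → (i : Fin n) ∈ h'
  · have hsub : h ⊆ h' := hown h' hh' hs
    have hns : ¬ h' ⊆ h := fun h1 => hne (Finset.Subset.antisymm h1 hsub)
    have hsupp : ∀ j, extend P j ≠ .I → j ∈ h' := fun j hj => hsub (extend_ne hj).1
    have h0 : ((4 : ℝ) ^ n)⁻¹ * ∑ S : PauliString n, chi (extend P) S * θ h' (restrict S h') =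
        0 := by
      rw [Finset.sum_congr rfl (g := fun S : PauliString n =>
        (fun q => chi (restrict (extend P) h') q * θ h' q) (restrict S h'))
        (fun S _ => by simp only [chi_restrict hsupp]), mean_restrict h'
        fun q => chi (restrict (extend P) h') q * θ h' q]
      rw [sum_mul_eq_zero_of_partial_sums (fun i : h' => (i : Fin n) ∈ h)
        ((hθ h' hh').2 h hh hns), mul_zero]
      intro Q Q' hQ
      refine Finset.prod_congr rfl fun j _ => ?_
      by_cases hj : (j : Fin n) ∈ h
      · rw [hQ j hj]
      · have : restrict (extend P) h' j = .I := by simp [restrict, extend, hj]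
        simp [this, Pauli.sign]
    have h4 : ((4 : ℝ) ^ n)⁻¹ ≠ 0 := by positivity
    exact (mul_eq_zero.1 h0).resolve_left h4
  · push Not at hs
    obtain ⟨j, hj, hj'⟩ := hs
    refine sum_chi_mul_eq_zero (j : Fin n) (by simpa [extend] using hj) fun Q Q' hQ => ?_
    rw [restrict_congr fun k hk => hQ k fun h => hj' (h ▸ hk)]

/-- Either `P` is trivial, and `θ^h` has mean zero, or some hyperedge contains the support of `P`
but not `h`, and the partial means of `θ^h` over it vanish. -/
theorem sum_chi_eq_zero_of_notMem_ownModes {H : Finset (Finset (Fin n))} {θ : Potentials n}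
    (hθ : Normalized H θ) {h : Finset (Fin n)} (hh : h ∈ H) {P : h → Pauli}
    (hP : P ∉ ownModes H h) : ∑ q, chi P q * θ h q = 0 := by
  by_cases h1 : ∃ i, P i ≠ .I
  · have : ∃ h' ∈ H, (∀ i : h, P i ≠ .I → (i : Fin n) ∈ h') ∧ ¬ h ⊆ h' := by
      by_contra! hc
      exact hP (Finset.mem_filter.2 ⟨mem_univ _, h1, hc⟩)
    obtain ⟨h', hh', hs, hns⟩ := this
    refine sum_mul_eq_zero_of_partial_sums (fun i : h => (i : Fin n) ∈ h')
        ((hθ h hh).2 h' hh' hns) fun Q Q' hQ => ?_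
    refine Finset.prod_congr rfl fun j _ => ?_
    by_cases hj : (j : Fin n) ∈ h'
    · rw [hQ j hj]
    · have : P j = .I := by
        by_contra hc
        exact hj (hs j hc)
      simp [this, Pauli.sign]
  · push Not at h1
    have : ∀ q, chi P q = 1 := fun q =>
      Finset.prod_eq_one fun i _ => by simp [h1 i, Pauli.sign]
    simp only [this, one_mul]
    exact (hθ h hh).1

/-- The logarithm of the marginal on `R_h` is the sum of the potentials that meet `h` and of a
function of the letters off `h`. -/
theorem exists_log_marginal_eq (H : Finset (Finset (Fin n))) (θ : Potentials n)
    (h : Finset (Fin n)) :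
    ∃ g : PauliString n → ℝ, (∀ S S' : PauliString n, (∀ i, i ∉ h → S i = S' i) → g S = g S') ∧
      ∀ S : PauliString n,
        Real.log (marginalOf (eigenvalue (gibbs H θ)) (region H h) (restrict S (region H h))) =
          ∑ h' ∈ H.filter (fun h' => ¬ Disjoint h' h), θ h' (restrict S h') + g S := by
  set R := region H h with hR
  -- `g` collects the hyperedges disjoint from `h` and the log-partition function. The factor of the
  -- hyperedges meeting `h` depends only on letters in `R_h` and leaves the sum over `T`.
  refine ⟨fun S => Real.log (∑ T, Real.exp (∑ h' ∈ H.filter (fun h' => ¬¬ Disjoint h' h),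
    θ h' (restrict (glue (restrict S R) T) h') -
      Real.log (∑ Q : PauliString n, Real.exp (energy H θ Q)))), ?_, ?_⟩
  · intro S S' hS
    refine congrArg Real.log (Finset.sum_congr rfl fun T _ => ?_)
    congr 2
    refine Finset.sum_congr rfl fun h' hh' => ?_
    have hd := not_not.1 (Finset.mem_filter.1 hh').2
    congr 1
    refine restrict_congr fun i hi => ?_
    by_cases hiR : i ∈ R
    · rw [glue_apply_mem _ _ hiR, glue_apply_mem _ _ hiR]
      exact hS i (Finset.disjoint_left.1 hd hi)
    · rw [glue_apply_notMem _ _ hiR, glue_apply_notMem _ _ hiR]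
  · intro S
    rw [marginalOf_eigenvalue]
    have hE : ∀ T, gibbs H θ (glue (restrict S R) T) =
        Real.exp (∑ h' ∈ H.filter (fun h' => ¬ Disjoint h' h), θ h' (restrict S h')) *
        Real.exp (∑ h' ∈ H.filter (fun h' => ¬¬ Disjoint h' h),
          θ h' (restrict (glue (restrict S R) T) h') -
            Real.log (∑ Q : PauliString n, Real.exp (energy H θ Q))) := by
      intro T
      rw [← Real.exp_add, gibbs, energy,
        ← Finset.sum_filter_add_sum_filter_not H (fun h' => ¬ Disjoint h' h), add_sub_assoc]
      congr 2
      refine Finset.sum_congr rfl fun h' hh' => ?_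
      obtain ⟨h1, h2⟩ := Finset.mem_filter.1 hh'
      congr 1
      refine restrict_congr fun i hi => ?_
      exact glue_apply_mem (A := R) _ _ (subset_region h1 h2 hi)
    simp only [hE]
    rw [← Finset.mul_sum, Real.log_mul (Real.exp_ne_zero _) (ne_of_gt _), Real.log_exp]
    exact Finset.sum_pos (fun _ _ => Real.exp_pos _) ⟨fun _ => .I, mem_univ _⟩

/-- Among all terms of the log-marginal, only `θ^h` contributes at an own mode of `h`. -/
theorem sum_chi_log_marginal {H : Finset (Finset (Fin n))} {θ : Potentials n}
    (hθ : Normalized H θ) {h : Finset (Fin n)} (hh : h ∈ H) {P : h → Pauli}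
    (hP : P ∈ ownModes H h) :
    ((4 : ℝ) ^ (region H h).card)⁻¹ * ∑ Q' : region H h → Pauli,
      chi (restrict (extend P) (region H h)) Q' *
        Real.log (marginalOf (eigenvalue (gibbs H θ)) (region H h) Q') =
      ((4 : ℝ) ^ h.card)⁻¹ * ∑ q, chi P q * θ h q := by
  obtain ⟨g, hg, hlog⟩ := exists_log_marginal_eq H θ h
  obtain ⟨-, ⟨i, hi⟩, -⟩ := Finset.mem_filter.1 hP
  have hsupp : ∀ j, extend P j ≠ .I → j ∈ region H h := fun j hj =>
    self_subset_region H h (extend_ne hj).1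
  rw [← mean_restrict (region H h) fun Q' => chi (restrict (extend P) (region H h)) Q' *
        Real.log (marginalOf (eigenvalue (gibbs H θ)) (region H h) Q'),
    ← mean_restrict h fun q => chi P q * θ h q]
  simp only [chi_restrict hsupp, hlog, mul_add, Finset.sum_add_distrib, Finset.mul_sum (H.filter _)]
  rw [sum_chi_mul_eq_zero (f := g) (i : Fin n) (by simpa [extend] using hi)
    fun Q Q' hQ => hg _ _ fun j hj => hQ j fun hji => hj (hji ▸ i.2)]
  rw [Finset.sum_comm, Finset.sum_eq_single h]
  · simp [chi_extend]
  · intro h' hh' hne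
    exact sum_chi_own_mode hθ hh (Finset.mem_filter.1 hh').1 hne hP
  · intro hc
    refine absurd (Finset.mem_filter.2 ⟨hh, fun hd => ?_⟩) hc
    exact Finset.disjoint_left.1 hd i.2 i.2

/-- Fourier inversion on `h`: the modes left out of the estimator are exactly those at which `θ^h`
is known to vanish. -/
theorem potentialEstimator_eigenvalue {H : Finset (Finset (Fin n))} {θ : Potentials n}
    (hθ : Normalized H θ) {h : Finset (Fin n)} (hh : h ∈ H) (Q : h → Pauli) :
    potentialEstimator H (eigenvalue (gibbs H θ)) h Q = θ h Q := by
  unfold potentialEstimator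
  rw [Finset.mul_sum, Finset.sum_congr rfl (g := fun P =>
    ((4 : ℝ) ^ h.card)⁻¹ * (chi P Q * ∑ q, chi P q * θ h q))]
  · rw [Finset.sum_subset (Finset.subset_univ _), ← Finset.mul_sum, sum_chi_mul_sum_chi,
      Fintype.card_coe, inv_mul_cancel_left₀ (by positivity)]
    intro P _ hP
    rw [sum_chi_eq_zero_of_notMem_ownModes hθ hh hP, mul_zero, mul_zero]
  · intro P hP
    rw [mul_left_comm, sum_chi_log_marginal hθ hh hP, mul_left_comm]

end Fourier

/-! ### Hypergraph counting, lower bounds on marginals, and stability of the estimator -/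

section Counting

/-! ### Counting hyperedges -/

/-- A finite set has at most `|S|^k` non-empty subsets of size at most `k`. -/
theorem card_family_le {α : Type*} [DecidableEq α] {F : Finset (Finset α)} {S : Finset α} {k : ℕ}
    (hF : ∀ t ∈ F, t.Nonempty ∧ t.card ≤ k ∧ t ⊆ S) : F.card ≤ S.card ^ k := by
  have hsub : F ⊆ (univ : Finset (Fin k → S)).image fun f => univ.image fun i => (f i : α) := by
    intro t ht
    obtain ⟨⟨a, ha⟩, hk, hS⟩ := hF t ht
    -- A non-empty set of size at most `k` is the image of a map from `Fin k`, and there are `|S|^k`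
    -- such maps into `S`.
    obtain ⟨e⟩ : Nonempty (t ↪ Fin k) :=
      Function.Embedding.nonempty_of_card_le (by simpa using hk)
    have : Nonempty t := ⟨⟨a, ha⟩⟩
    obtain ⟨g, hsurj⟩ : ∃ g : Fin k → t, Function.Surjective g :=
      ⟨_, Function.invFun_surjective e.injective⟩
    refine Finset.mem_image.2 ⟨fun i => ⟨g i, hS (g i).2⟩, mem_univ _, ?_⟩
    ext b
    simp only [Finset.mem_image, Finset.mem_univ, true_and]
    constructor
    · rintro ⟨i, rfl⟩
      exact (g i).2
    · intro hb
      obtain ⟨i, hi⟩ := hsurj ⟨b, hb⟩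
      exact ⟨i, by rw [hi]⟩
  refine (Finset.card_le_card hsub).trans (Finset.card_image_le.trans ?_)
  simp

variable {n r D : ℕ} {H : Finset (Finset (Fin n))}

/-- The neighbours of a vertex. -/
def neighbours (H : Finset (Finset (Fin n))) (v : Fin n) : Finset (Fin n) :=
  univ.filter fun w => v ≠ w ∧ ∃ h ∈ H, v ∈ h ∧ w ∈ h

theorem card_neighbours (v : Fin n) :
    (neighbours H v).card = ((interactionGraph H).neighborSet v).ncard := by
  rw [← Set.ncard_coe_finset]
  congr 1
  ext w
  simp [neighbours, interactionGraph]

theorem mem_neighbours {v w : Fin n} {h : Finset (Fin n)} (hh : h ∈ H) (hv : v ∈ h) (hw : w ∈ h)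
    (hne : v ≠ w) : w ∈ neighbours H v :=
  Finset.mem_filter.2 ⟨mem_univ _, hne, h, hh, hv, hw⟩

theorem mem_region {h : Finset (Fin n)} {w : Fin n} :
    w ∈ region H h ↔ w ∈ h ∨ ∃ h' ∈ H, w ∈ h' ∧ ∃ v ∈ h', v ∈ h := by
  simp only [region, Finset.mem_union, Finset.mem_biUnion, Finset.mem_filter, id,
    Finset.not_disjoint_iff]
  constructor
  · rintro (hw | ⟨h', ⟨hh', v, hv, hv'⟩, hw⟩)
    · exact Or.inl hw
    · exact Or.inr ⟨h', hh', hw, v, hv, hv'⟩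
  · rintro (hw | ⟨h', hh', hw, v, hv, hv'⟩)
    · exact Or.inl hw
    · exact Or.inr ⟨h', ⟨hh', v, hv, hv'⟩, hw⟩

theorem card_region_le_one (hH : ∀ h ∈ H, h.Nonempty ∧ h.card ≤ 1) {h : Finset (Fin n)}
    (hh : h ∈ H) : (region H h).card ≤ 1 := by
  have : region H h ⊆ h := by
    intro w hw
    rcases mem_region.1 hw with hw | ⟨h', hh', hw, v, hv, hv'⟩
    · exact hw
    · rwa [Finset.card_le_one.1 (hH h' hh').2 w hw v hv]
  exact (Finset.card_le_card this).trans (hH h hh).2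

/-- If `h` has two vertices, each vertex of `R_h` is a neighbour of a vertex of `h`, including those
of `h` itself. A singleton `h` needs the extra vertex, and `D + 1 ≤ 2 * D` covers it for `r ≥ 2`;
for `r = 1` the region is `h`. -/
theorem card_region_le (hD : 1 ≤ D) (hH : ∀ h ∈ H, h.Nonempty ∧ h.card ≤ r)
    (hdeg : ∀ v, (neighbours H v).card ≤ D) {h : Finset (Fin n)} (hh : h ∈ H) :
    (region H h).card ≤ r * D := by
  have hpos : 1 ≤ h.card := Finset.card_pos.2 (hH h hh).1
  rcases Nat.lt_or_ge h.card 2 with h1 | h2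
  · rcases Nat.lt_or_ge r 2 with hr1 | hr2
    · have hr : r = 1 := le_antisymm (by omega) (hpos.trans (hH h hh).2)
      subst hr
      exact (card_region_le_one hH hh).trans (by omega)
    · obtain ⟨v, rfl⟩ := Finset.card_eq_one.1 (show h.card = 1 by omega)
      have hsub : region H {v} ⊆ insert v (neighbours H v) := by
        intro w hw
        rcases mem_region.1 hw with hw | ⟨h', hh', hw, u, hu, hu'⟩
        · exact Finset.mem_insert.2 (Or.inl (Finset.mem_singleton.1 hw))
        · rw [Finset.mem_singleton.1 hu'] at hu
          by_cases hvw : v = w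
          · exact Finset.mem_insert.2 (Or.inl hvw.symm)
          · exact Finset.mem_insert_of_mem (mem_neighbours hh' hu hw hvw)
      calc (region H {v}).card ≤ (neighbours H v).card + 1 :=
            (Finset.card_le_card hsub).trans (Finset.card_insert_le _ _)
        _ ≤ 2 * D := by have := hdeg v; omega
        _ ≤ r * D := Nat.mul_le_mul_right _ hr2
  · have hself : ∀ w ∈ h, ∃ v ∈ h, w ∈ neighbours H v := by
      intro w hw
      obtain ⟨v, hv, hne⟩ := Finset.exists_mem_ne (by omega : 1 < h.card) w
      exact ⟨v, hv, mem_neighbours hh hv hw hne⟩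
    have hsub : region H h ⊆ h.biUnion (neighbours H) := by
      intro w hw
      rw [Finset.mem_biUnion]
      rcases mem_region.1 hw with hw | ⟨h', hh', hw, v, hv, hv'⟩
      · exact hself w hw
      · by_cases hvw : v = w
        · exact hself w (hvw ▸ hv')
        · exact ⟨v, hv', mem_neighbours hh' hv hw hvw⟩
    calc (region H h).card ≤ h.card * D := (Finset.card_le_card hsub).trans
          (Finset.card_biUnion_le_card_mul _ _ _ fun v _ => hdeg v)
      _ ≤ r * D := Nat.mul_le_mul_right _ (hH h hh).2

/-- Removing `v` turns hyperedges at `v` into sets of at most `r - 1` neighbours of `v`. All are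
non-empty except the one coming from `{v}`, whence the `+ 1`. -/
theorem card_hyperedges_at_le (hH : ∀ h ∈ H, h.Nonempty ∧ h.card ≤ r)
    (hdeg : ∀ v, (neighbours H v).card ≤ D) (v : Fin n) :
    (H.filter fun h => v ∈ h).card ≤ D ^ (r - 1) + 1 := by
  have hinj : Set.InjOn (fun t : Finset (Fin n) => t.erase v) (H.filter fun h => v ∈ h) := by
    intro s hs t ht hst
    rw [← Finset.insert_erase (Finset.mem_filter.1 hs).2,
      ← Finset.insert_erase (Finset.mem_filter.1 ht).2]
    exact congrArg (insert v) hst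
  rw [← Finset.card_image_of_injOn hinj]
  refine (Nat.sub_le_iff_le_add.1 (Finset.pred_card_le_card_erase (a := ∅))).trans
    (Nat.add_le_add_right ?_ 1)
  refine (card_family_le (S := neighbours H v) (k := r - 1) ?_).trans
    (Nat.pow_le_pow_left (hdeg v) _)
  intro t ht
  obtain ⟨hne, ht⟩ := Finset.mem_erase.1 ht
  obtain ⟨s, hs, rfl⟩ := Finset.mem_image.1 ht
  obtain ⟨hsH, hv⟩ := Finset.mem_filter.1 hs
  refine ⟨Finset.nonempty_iff_ne_empty.2 hne, ?_, fun w hw => ?_⟩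
  · rw [Finset.card_erase_of_mem hv]
    exact Nat.sub_le_sub_right (hH s hsH).2 1
  · obtain ⟨hwv, hw⟩ := Finset.mem_erase.1 hw
    exact mem_neighbours hsH hv hw hwv.symm

theorem card_touching_le (hH : ∀ h ∈ H, h.Nonempty ∧ h.card ≤ r)
    (hdeg : ∀ v, (neighbours H v).card ≤ D) (R : Finset (Fin n)) :
    (H.filter fun h => ¬ Disjoint h R).card ≤ R.card * (D ^ (r - 1) + 1) := by
  refine le_trans (Finset.card_le_card ?_) (Finset.card_biUnion_le_card_mul R
    (fun v => H.filter fun h => v ∈ h) _ fun v _ => card_hyperedges_at_le hH hdeg v)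
  intro h hh
  obtain ⟨hh, hd⟩ := Finset.mem_filter.1 hh
  obtain ⟨v, hv, hvR⟩ := Finset.not_disjoint_iff.1 hd
  exact Finset.mem_biUnion.2 ⟨v, hvR, Finset.mem_filter.2 ⟨hh, hv⟩⟩

/-- The factor `4` is the `2β` per hyperedge in the marginal bound, doubled because the accuracy
enters the rate squared. The `+ 1` keeps a spare factor `exp β`, needed when `ε > 1`. This is where
`D ≥ 5` enters. -/
theorem four_mul_card_touching_region_lt (hr : 1 ≤ r) (hD : 5 ≤ D)
    (hH : ∀ h ∈ H, h.Nonempty ∧ h.card ≤ r) (hdeg : ∀ v, (neighbours H v).card ≤ D)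
    {h : Finset (Fin n)} (hh : h ∈ H) :
    4 * (H.filter fun h' => ¬ Disjoint h' (region H h)).card + 1 ≤ r * D ^ (r + 1) := by
  have h1 := card_touching_le hH hdeg (region H h)
  rcases Nat.lt_or_ge r 2 with hr1 | hr2
  · have hr : r = 1 := by omega
    subst hr
    have h2 := card_region_le_one hH hh
    simp only [Nat.sub_self, pow_zero] at h1
    have : 5 ^ (1 + 1) ≤ D ^ (1 + 1) := Nat.pow_le_pow_left hD _
    omega
  · obtain ⟨s, rfl⟩ := Nat.exists_eq_add_of_le' hr2
    have h2 := card_region_le (by omega) hH hdeg hh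
    have h3 := h1.trans (Nat.mul_le_mul_right _ h2)
    have h4 : 1 ≤ D ^ s := Nat.one_le_pow _ _ (by omega)
    have h5 : (s + 2) * D * (D ^ (s + 2 - 1) + 1) = (s + 2) * D * (D * D ^ s) + (s + 2) * D := by
      rw [show s + 2 - 1 = s + 1 by omega]; ring
    have h6 : (s + 2) * D ^ (s + 2 + 1) = (s + 2) * D * (D * D ^ s) * D := by ring
    rw [h5] at h3
    rw [h6]
    have h7 : 5 ≤ D * D ^ s := by nlinarith
    have h8 : (s + 2) * D * 5 ≤ (s + 2) * D * (D * D ^ s) := Nat.mul_le_mul_left _ h7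
    have h9 : (s + 2) * D * (D * D ^ s) * 5 ≤ (s + 2) * D * (D * D ^ s) * D :=
      Nat.mul_le_mul_left _ hD
    have h10 : 1 ≤ (s + 2) * D := Nat.mul_pos (by omega) (by omega)
    omega

theorem card_hypergraph_le (hH : ∀ h ∈ H, h.Nonempty ∧ h.card ≤ r) : H.card ≤ n ^ r := by
  simpa using card_family_le (S := univ) fun h hh =>
    ⟨(hH h hh).1, (hH h hh).2, Finset.subset_univ h⟩

/-! ### Lower bound on the marginals -/

/-- Only hyperedges meeting `A` feel a change of the letters on `A`, and each changes the energy by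
at most `2β`; the partition function is common to both sides. -/
theorem exp_mul_gibbs_glue_le {θ : Potentials n} {β : ℝ} (hβ : ∀ h ∈ H, ∀ Q, |θ h Q| ≤ β)
    {A : Finset (Fin n)} (Q Q' : A → Pauli) (T : {i // i ∉ A} → Pauli) :
    Real.exp (-(2 * β * (H.filter fun h => ¬ Disjoint h A).card)) * gibbs H θ (glue Q' T) ≤
      gibbs H θ (glue Q T) := by
  rw [gibbs, gibbs, ← Real.exp_add, Real.exp_le_exp]
  have : energy H θ (glue Q' T) - energy H θ (glue Q T) ≤
      2 * β * (H.filter fun h => ¬ Disjoint h A).card := by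
    rw [energy, energy, ← Finset.sum_sub_distrib]
    rw [← Finset.sum_subset (Finset.filter_subset (fun h => ¬ Disjoint h A) H)]
    · rw [mul_comm (2 * β), ← nsmul_eq_mul]
      refine Finset.sum_le_card_nsmul _ _ _ fun h hh => ?_
      have h1 := hβ h (Finset.mem_filter.1 hh).1
      have h2 := abs_le.1 (h1 (restrict (glue Q T) h))
      have h3 := abs_le.1 (h1 (restrict (glue Q' T) h))
      linarith [h2.1, h3.2]
    · intro h hh hn
      have hd : Disjoint h A := by
        by_contra hc
        exact hn (Finset.mem_filter.2 ⟨hh, hc⟩)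
      rw [sub_eq_zero]
      congr 1
      refine restrict_congr fun i hi => ?_
      have hiA : i ∉ A := Finset.disjoint_left.1 hd hi
      rw [glue_apply_notMem _ _ hiA, glue_apply_notMem _ _ hiA]
  linarith

/-- Summing the previous comparison over all `4^|A|` strings `Q'` gives total mass `1` on the left.
-/
theorem marginalOf_gibbs_ge {θ : Potentials n} {β : ℝ} (hβ : ∀ h ∈ H, ∀ Q, |θ h Q| ≤ β)
    (A : Finset (Fin n)) (Q : A → Pauli) :
    ((4 : ℝ) ^ A.card)⁻¹ * Real.exp (-(2 * β * (H.filter fun h => ¬ Disjoint h A).card)) ≤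
      marginalOf (eigenvalue (gibbs H θ)) A Q := by
  set c := Real.exp (-(2 * β * (H.filter fun h => ¬ Disjoint h A).card))
  have h1 : ∑ Q' : A → Pauli, c * ∑ T, gibbs H θ (glue Q' T) ≤
      ∑ _Q' : A → Pauli, ∑ T, gibbs H θ (glue Q T) := by
    refine Finset.sum_le_sum fun Q' _ => ?_
    rw [Finset.mul_sum]
    exact Finset.sum_le_sum fun T _ => exp_mul_gibbs_glue_le hβ Q Q' T
  rw [← Finset.mul_sum, ← sum_eq_sum_glue, sum_gibbs, mul_one, Finset.sum_const, nsmul_eq_mul,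
    ← marginalOf_eigenvalue, Finset.card_univ] at h1
  simp only [Fintype.card_fun, Pauli.card_eq_four, Fintype.card_coe, Nat.cast_pow,
    Nat.cast_ofNat] at h1
  rwa [inv_mul_le_iff₀ (by positivity)]

/-! ### Stability of the estimator -/

theorem abs_marginalOf_sub_le {a b : PauliString n → ℝ} {A : Finset (Fin n)} {η : ℝ}
    (h : ∀ P : A → Pauli, |a (extend P) - b (extend P)| ≤ η) (Q : A → Pauli) :
    |marginalOf a A Q - marginalOf b A Q| ≤ η := by
  rw [marginalOf, marginalOf, ← mul_sub, ← Finset.sum_sub_distrib, abs_mul,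
    abs_of_nonneg (by positivity), inv_mul_le_iff₀ (by positivity)]
  refine (Finset.abs_sum_le_sum_abs _ _).trans ?_
  refine (Finset.sum_le_card_nsmul _ _ η fun P _ => ?_).trans (le_of_eq ?_)
  · rw [← mul_sub, abs_mul, abs_chi, one_mul]
    exact h P
  · rw [nsmul_eq_mul, Finset.card_univ]
    simp [Pauli.card_eq_four]

/-- The condition `2 * η ≤ m` keeps `x` above `m / 2`; both directions then follow from `log t ≤ t -
1`. -/
theorem abs_log_sub_log_le {x y η m : ℝ} (hm : 0 < m) (hy : m ≤ y) (hxy : |x - y| ≤ η)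
    (hη : 2 * η ≤ m) : |Real.log x - Real.log y| ≤ 2 * η / m := by
  obtain ⟨h1, h2⟩ := abs_le.1 hxy
  have hη0 : 0 ≤ η := (abs_nonneg _).trans hxy
  have hy0 : 0 < y := hm.trans_le hy
  have hx : m / 2 ≤ x := by linarith
  have hx0 : 0 < x := by linarith
  rw [abs_le]
  constructor
  · have h3 := Real.log_le_sub_one_of_pos (div_pos hy0 hx0)
    rw [Real.log_div hy0.ne' hx0.ne'] at h3
    have h4 : y / x - 1 ≤ 2 * η / m := by
      rw [div_sub_one hx0.ne', div_le_div_iff₀ hx0 hm]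
      nlinarith
    linarith
  · have h3 := Real.log_le_sub_one_of_pos (div_pos hx0 hy0)
    rw [Real.log_div hx0.ne' hy0.ne'] at h3
    have h4 : x / y - 1 ≤ 2 * η / m := by
      rw [div_sub_one hy0.ne', div_le_div_iff₀ hy0 hm]
      nlinarith
    linarith

/-- Each Fourier coefficient is an average over `R_h` and moves by at most `c`, and there are at
most `4^|h|` own modes. -/
theorem abs_potentialEstimator_sub_le {a b : PauliString n → ℝ} {h : Finset (Fin n)} {c : ℝ}
    (hc : ∀ Q', |Real.log (marginalOf a (region H h) Q') -
      Real.log (marginalOf b (region H h) Q')| ≤ c) (Q : h → Pauli) :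
    |potentialEstimator H a h Q - potentialEstimator H b h Q| ≤ 4 ^ h.card * c := by
  have hc0 : 0 ≤ c := (abs_nonneg _).trans (hc fun _ => .I)
  rw [potentialEstimator, potentialEstimator, ← mul_sub, ← Finset.sum_sub_distrib, abs_mul,
    abs_of_nonneg (by positivity), inv_mul_le_iff₀ (by positivity)]
  refine (Finset.abs_sum_le_sum_abs _ _).trans ?_
  refine (Finset.sum_le_card_nsmul _ _ (4 ^ (region H h).card * c) fun P _ => ?_).trans ?_
  · rw [← mul_sub, abs_mul, abs_chi, one_mul, ← Finset.sum_sub_distrib]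
    refine (Finset.abs_sum_le_sum_abs _ _).trans ?_
    refine (Finset.sum_le_card_nsmul _ _ c fun P _ => ?_).trans (le_of_eq ?_)
    · rw [← mul_sub, abs_mul, abs_chi, one_mul]
      exact hc P
    · rw [nsmul_eq_mul, Finset.card_univ]
      simp [Pauli.card_eq_four]
  · rw [nsmul_eq_mul, mul_left_comm]
    gcongr
    have := Finset.card_le_univ (ownModes H h)
    simp only [Fintype.card_fun, Pauli.card_eq_four, Fintype.card_coe] at this
    exact_mod_cast this

end Counting

/-! ### Pauli twirling and conjugation by single-qubit Clifford gates -/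

section PauliTwirl

/-! ### Tensor products -/

section Tensor

variable {n : ℕ}

theorem tensor_mul (A B : Fin n → Matrix (Fin 2) (Fin 2) ℂ) :
    tensor A * tensor B = tensor fun i => A i * B i := by
  ext x y
  simp only [Matrix.mul_apply, tensor, Matrix.of_apply, ← Finset.prod_mul_distrib]
  exact (Fintype.prod_sum fun i j => A i (x i) j * B i j (y i)).symm

theorem conjTranspose_tensor (A : Fin n → Matrix (Fin 2) (Fin 2) ℂ) :
    (tensor A)ᴴ = tensor fun i => (A i)ᴴ := by
  ext x y
  simp [tensor, Matrix.conjTranspose_apply]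

theorem tensor_one : tensor (fun _ : Fin n => (1 : Matrix (Fin 2) (Fin 2) ℂ)) = 1 := by
  ext x y
  simp only [tensor, Matrix.of_apply, Matrix.one_apply]
  split_ifs with h
  · simp [h]
  · obtain ⟨i, hi⟩ := Function.ne_iff.1 h
    exact Finset.prod_eq_zero (mem_univ i) (if_neg hi)

theorem tensor_smul (c : Fin n → ℂ) (A : Fin n → Matrix (Fin 2) (Fin 2) ℂ) :
    tensor (fun i => c i • A i) = (∏ i, c i) • tensor A := by
  ext x y
  simp [tensor, Finset.prod_mul_distrib]

theorem Pauli.conjTranspose_mat (p : Pauli) : p.matᴴ = p.mat := by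
  cases p <;> ext i j <;> fin_cases i <;> fin_cases j <;> simp [Pauli.mat]

theorem Pauli.mat_mul_self (p : Pauli) : p.mat * p.mat = 1 := by
  cases p <;> simp [Pauli.mat, Matrix.one_fin_two]

theorem conjTranspose_pauliOp (P : PauliString n) : (pauliOp P)ᴴ = pauliOp P := by
  simp [pauliOp, conjTranspose_tensor, Pauli.conjTranspose_mat]

theorem pauliOp_mul_self (P : PauliString n) : pauliOp P * pauliOp P = 1 := by
  simp [pauliOp, tensor_mul, Pauli.mat_mul_self, tensor_one]

theorem pauliOp_mul_comm (P Q : PauliString n) :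
    pauliOp P * pauliOp Q = ((chi P Q : ℝ) : ℂ) • (pauliOp Q * pauliOp P) := by
  simp only [pauliOp, tensor_mul, chi, Complex.ofReal_prod, ← tensor_smul]
  congr 1
  funext i
  exact Pauli.mat_mul_comm _ _

theorem pauliOp_idString : pauliOp (idString n) = 1 := tensor_one

theorem conjBy_apply (A X : Op n) : conjBy A X = A * X * Aᴴ := by
  simp [conjBy, Matrix.mul_assoc]

theorem conjBy_pauliOp (P Q : PauliString n) :
    conjBy (pauliOp Q) (pauliOp P) = ((chi P Q : ℝ) : ℂ) • pauliOp P := by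
  rw [conjBy_apply, conjTranspose_pauliOp, pauliOp_mul_comm, chi_comm, Matrix.smul_mul,
    Matrix.mul_assoc, pauliOp_mul_self, Matrix.mul_one]

theorem pauliChannel_pauliOp (μ : PauliString n → ℝ) (P : PauliString n) :
    pauliChannel μ (pauliOp P) = ((eigenvalue μ P : ℝ) : ℂ) • pauliOp P := by
  simp only [pauliChannel, eigenvalue, LinearMap.sum_apply, LinearMap.smul_apply, conjBy_pauliOp,
    Complex.ofReal_sum, Complex.ofReal_mul, Finset.sum_smul, smul_smul]

theorem pauliChannel_pow_pauliOp (μ : PauliString n → ℝ) (k : ℕ) (P : PauliString n) :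
    (pauliChannel μ ^ k) (pauliOp P) = ((eigenvalue μ P : ℝ) : ℂ) ^ k • pauliOp P := by
  induction k with
  | zero => simp
  | succ k ih => rw [pow_succ', Module.End.mul_apply, ih, map_smul, pauliChannel_pauliOp,
      smul_smul, pow_succ]

end Tensor

/-! ### Twirling over the Pauli group -/

section Twirl

theorem Pauli.sum_sign_mul_mat (p : Pauli) (x u y v : Fin 2) :
    ∑ q : Pauli, ((p.sign q : ℝ) : ℂ) * (q.mat x u * star (q.mat y v)) =
      2 * (p.mat v u * p.mat x y) := by
  rw [Pauli.sum_univ]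
  cases p <;> fin_cases x <;> fin_cases u <;> fin_cases y <;> fin_cases v <;>
    simp [Pauli.sign, Pauli.mat] <;> norm_num

variable {n : ℕ}

theorem sum_chi_mul_pauliOp (P : PauliString n) (x u y v : Fin n → Fin 2) :
    ∑ Q, ((chi P Q : ℝ) : ℂ) * (pauliOp Q x u * star (pauliOp Q y v)) =
      2 ^ n * (pauliOp P v u * pauliOp P x y) := by
  simp only [chi, pauliOp, tensor, Matrix.of_apply, Complex.ofReal_prod, star_prod,
    ← Finset.prod_mul_distrib]
  rw [← Fintype.prod_sum fun i (q : Pauli) => (((P i).sign q : ℝ) : ℂ) *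
    (q.mat (x i) (u i) * star (q.mat (y i) (v i)))]
  simp only [Pauli.sum_sign_mul_mat, Finset.prod_mul_distrib]
  simp

/-- The character-weighted twirl keeps only the component of `A` along `P`, which is `2^{-n} tr(P
A)`, with multiplicity `4^n`. -/
theorem sum_chi_smul_conjBy (P : PauliString n) (A : Op n) :
    ∑ Q, ((chi P Q : ℝ) : ℂ) • conjBy (pauliOp Q) A =
      (2 ^ n * trace (pauliOp P * A)) • pauliOp P := by
  ext x y
  simp only [Matrix.sum_apply, Matrix.smul_apply, conjBy_apply, Matrix.mul_apply,
    Matrix.conjTranspose_apply, smul_eq_mul, Matrix.trace, Matrix.diag, Finset.sum_mul,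
    Finset.mul_sum]
  rw [Finset.sum_comm]
  refine Finset.sum_congr rfl fun v _ => ?_
  rw [Finset.sum_comm]
  refine Finset.sum_congr rfl fun u _ => ?_
  rw [Finset.sum_congr rfl (g := fun Q => ((chi P Q : ℝ) : ℂ) *
    (pauliOp Q x u * star (pauliOp Q y v)) * A u v) (fun Q _ => by ring), ← Finset.sum_mul,
    sum_chi_mul_pauliOp]
  ring

end Twirl

/-! ### Averaging over single-qubit Clifford gates -/

section CliffordAverage

theorem inv_sqrt_two_mul_self :
    ((Real.sqrt 2 : ℝ) : ℂ)⁻¹ * ((Real.sqrt 2 : ℝ) : ℂ)⁻¹ = 1 / 2 := by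
  rw [← mul_inv, ← Complex.ofReal_mul, Real.mul_self_sqrt (by norm_num)]
  norm_num

/-- The representatives of the single-qubit Clifford group modulo the Pauli group. -/
noncomputable def cosetRep (g : Fin 6) : Matrix (Fin 2) (Fin 2) ℂ :=
  ![1, gateH, gateS, gateH * gateS, gateS * gateH, gateH * gateS * gateH] g

/-- Whether the gate with number `g` diagonalizes the Pauli matrix `p`. -/
def diagonalizes (g : Fin 6) (p : Pauli) : Prop :=
  p = .I ∨ p = ![Pauli.Z, .X, .Z, .X, .Y, .Y] g

instance (g : Fin 6) (p : Pauli) : Decidable (diagonalizes g p) :=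
  inferInstanceAs (Decidable (_ ∨ _))

/-- The map `p ↦ H† p H` on Pauli labels, up to signs. -/
def hadamardAction : Pauli → Pauli
  | .I => .I
  | .X => .Z
  | .Y => .Y
  | .Z => .X

/-- The map `p ↦ S† p S` on Pauli labels, up to signs. -/
def phaseAction : Pauli → Pauli
  | .I => .I
  | .X => .Y
  | .Y => .X
  | .Z => .Z

theorem gateH_conj (p : Pauli) :
    gateHᴴ * p.mat * gateH = (if p = .Y then (-1 : ℂ) else 1) • (hadamardAction p).mat := by
  have h : gateHᴴ * p.mat * gateH =
      (1 / 2 : ℂ) • (!![1, 1; 1, -1] * p.mat * !![1, 1; 1, -1]) := by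
    rw [← inv_sqrt_two_mul_self, gateH, Matrix.conjTranspose_smul, Matrix.smul_mul,
      Matrix.smul_mul, Matrix.mul_smul, smul_smul]
    congr 1
    · simp
    · congr 2
      ext i j
      fin_cases i <;> fin_cases j <;> simp
  rw [h]
  cases p <;> ext i j <;> fin_cases i <;> fin_cases j <;>
    simp [Pauli.mat, hadamardAction] <;> ring

theorem gateS_conj (p : Pauli) :
    gateSᴴ * p.mat * gateS = (if p = .X then (-1 : ℂ) else 1) • (phaseAction p).mat := by
  cases p <;> ext i j <;> fin_cases i <;> fin_cases j <;>
    simp [Pauli.mat, phaseAction, gateS, Matrix.mul_apply, Fin.sum_univ_two]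

theorem conj_trans {G G' : Matrix (Fin 2) (Fin 2) ℂ} {p p' p'' : Pauli} {c c' : ℂ}
    (h : Gᴴ * p.mat * G = c • p'.mat) (h' : G'ᴴ * p'.mat * G' = c' • p''.mat) :
    (G * G')ᴴ * p.mat * (G * G') = (c * c') • p''.mat := by
  calc (G * G')ᴴ * p.mat * (G * G') = G'ᴴ * (Gᴴ * p.mat * G) * G' := by
        simp only [Matrix.conjTranspose_mul, Matrix.mul_assoc]
    _ = _ := by rw [h, Matrix.mul_smul, Matrix.smul_mul, h', smul_smul]

theorem cosetRep_unitary (g : Fin 6) : (cosetRep g)ᴴ * cosetRep g = 1 := by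
  have hH : gateHᴴ * gateH = 1 := by
    simpa [Pauli.mat, hadamardAction] using gateH_conj .I
  have hS : gateSᴴ * gateS = 1 := by
    simpa [Pauli.mat, phaseAction] using gateS_conj .I
  have hmul : ∀ A B : Matrix (Fin 2) (Fin 2) ℂ, Aᴴ * A = 1 → Bᴴ * B = 1 →
      (A * B)ᴴ * (A * B) = 1 := by
    intro A B hA hB
    rw [Matrix.conjTranspose_mul, Matrix.mul_assoc, ← Matrix.mul_assoc Aᴴ, hA, Matrix.one_mul, hB]
  fin_cases g
  · simp [cosetRep]
  · exact hH
  · exact hS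
  · exact hmul _ _ hH hS
  · exact hmul _ _ hS hH
  · exact hmul _ _ (hmul _ _ hH hS) hH

/-- Only the label of the conjugated Pauli matters for whether it is diagonal; the sign `c` cancels
later, since the conjugate is used again to reconstruct `p`. -/
theorem exists_cosetRep_conj (g : Fin 6) (p : Pauli) :
    ∃ (c : ℂ) (p' : Pauli), (cosetRep g)ᴴ * p.mat * cosetRep g = c • p'.mat ∧
      ((p' = .I ∨ p' = .Z) ↔ diagonalizes g p) := by
  fin_cases g
  · refine ⟨1, p, by simp [cosetRep], ?_⟩
    cases p <;> simp [diagonalizes]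
  · refine ⟨_, _, gateH_conj p, ?_⟩
    cases p <;> simp [diagonalizes, hadamardAction]
  · refine ⟨_, _, gateS_conj p, ?_⟩
    cases p <;> simp [diagonalizes, phaseAction]
  · refine ⟨_, _, conj_trans (gateH_conj p) (gateS_conj _), ?_⟩
    cases p <;> simp [diagonalizes, phaseAction, hadamardAction]
  · refine ⟨_, _, conj_trans (gateS_conj p) (gateH_conj _), ?_⟩
    cases p <;> simp [diagonalizes, phaseAction, hadamardAction]
  · refine ⟨_, _, conj_trans (conj_trans (gateH_conj p) (gateS_conj _)) (gateH_conj _), ?_⟩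
    cases p <;> simp [diagonalizes, phaseAction, hadamardAction]

/-- The left side is an entry of `U diag(U† p U) U†`. This is `p` when `U† p U` is diagonal, and `0`
otherwise, since `X` and `Y` have zero diagonal. -/
theorem sum_diag_cosetRep (g : Fin 6) (p : Pauli) (a b : Fin 2) :
    ∑ x, ((cosetRep g)ᴴ * p.mat * cosetRep g) x x * (cosetRep g a x * star (cosetRep g b x)) =
      if diagonalizes g p then p.mat a b else 0 := by
  obtain ⟨c, p', hN, hp'⟩ := exists_cosetRep_conj g p
  have hU := mul_eq_one_comm.1 (cosetRep_unitary g)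
  have hp : p.mat = cosetRep g * (c • p'.mat) * (cosetRep g)ᴴ := by
    rw [← hN]
    simp only [← Matrix.mul_assoc, hU, Matrix.one_mul]
    rw [Matrix.mul_assoc, hU, Matrix.mul_one]
  rw [hN]
  simp only [← hp']
  split_ifs with h
  · rw [hp]
    rcases h with rfl | rfl <;>
      simp [Pauli.mat, Matrix.mul_apply, Fin.sum_univ_two] <;> ring
  · cases p' <;> simp_all [Pauli.mat, Fin.sum_univ_two]

/-- Averaging over the Pauli part of a Clifford gate. -/
theorem sum_pauli_mul_diag (G : Matrix (Fin 2) (Fin 2) ℂ) (N : Matrix (Fin 2) (Fin 2) ℂ)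
    (a b d e : Fin 2) :
    ∑ q : Pauli, ∑ x : Fin 2, (q.matᴴ * N * q.mat) x x * (q.matᴴ * N * q.mat) 0 0 *
        (((G * q.mat) a 0 * star ((G * q.mat) b 0)) *
          (star ((G * q.mat) d x) * (G * q.mat) e x)) =
      2 * ((∑ x, N x x * (G a x * star (G b x))) * ∑ x, N x x * (G e x * star (G d x))) := by
  -- Two letters `q` send the basis label `0` to `0` and two send it to `1`, while `x` ranges over
  -- both outcomes in each case. The joint sum thus factorizes, with multiplicity `2`; the entries
  -- of `Y` leave powers of `I` to clear.
  have h4 := Complex.I_pow_four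
  have h8 : Complex.I ^ 8 = 1 := by rw [show 8 = 4 + 4 from rfl, pow_add, h4]; simp
  simp only [Pauli.conjTranspose_mat]
  rw [Pauli.sum_univ]
  simp [Pauli.mat, Matrix.mul_apply, Fin.sum_univ_two, Matrix.vecMul, dotProduct]
  ring_nf
  simp only [h8]
  ring

end CliffordAverage

end PauliTwirl

/-! ### The average over the Clifford layer -/

section CliffordTwirl

section CliffordAverage

/-- A non-identity letter is diagonalized by two of the six representatives and the identity by all
six. The weight `3` equalizes the two cases, and the Pauli part contributes `2`, whence `12`. -/
theorem sum_cliffordMat (p : Pauli) (a b d e : Fin 2) :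
    ∑ c : Clifford, ∑ x : Fin 2, (if p ≠ .I then 3 else 1 : ℂ) *
        (((cliffordMat c)ᴴ * p.mat * cliffordMat c) x x *
          ((cliffordMat c)ᴴ * p.mat * cliffordMat c) 0 0 *
        ((cliffordMat c a 0 * star (cliffordMat c b 0)) *
          (star (cliffordMat c d x) * cliffordMat c e x))) =
      12 * (p.mat a b * p.mat e d) := by
  have hM : ∀ (g : Fin 6) (q : Pauli),
      (cliffordMat (g, q))ᴴ * p.mat * cliffordMat (g, q) =
        q.matᴴ * ((cosetRep g)ᴴ * p.mat * cosetRep g) * q.mat := by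
    intro g q
    change (cosetRep g * q.mat)ᴴ * p.mat * (cosetRep g * q.mat) = _
    simp only [Matrix.conjTranspose_mul, Matrix.mul_assoc]
  simp only [← Finset.mul_sum]
  rw [Fintype.sum_prod_type]
  simp only [hM]
  have h : ∀ g : Fin 6, ∑ q : Pauli, ∑ x : Fin 2,
      (q.matᴴ * ((cosetRep g)ᴴ * p.mat * cosetRep g) * q.mat) x x *
        (q.matᴴ * ((cosetRep g)ᴴ * p.mat * cosetRep g) * q.mat) 0 0 *
        ((cliffordMat (g, q) a 0 * star (cliffordMat (g, q) b 0)) *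
          (star (cliffordMat (g, q) d x) * cliffordMat (g, q) e x)) =
      if diagonalizes g p then 2 * (p.mat a b * p.mat e d) else 0 := by
    intro g
    refine (sum_pauli_mul_diag (cosetRep g) ((cosetRep g)ᴴ * p.mat * cosetRep g) a b d e).trans ?_
    rw [sum_diag_cosetRep, sum_diag_cosetRep]
    split_ifs <;> simp
  simp only [h]
  rw [Fin.sum_univ_six]
  cases p <;> simp [diagonalizes] <;> ring

variable {n : ℕ}

theorem pow_weight (P : PauliString n) :
    (3 : ℂ) ^ weight P = ∏ i, if P i ≠ .I then 3 else 1 := by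
  rw [Finset.prod_ite]
  simp [weight]

/-- The operator `C† P C`. -/
noncomputable def rotated (P : PauliString n) (C : Fin n → Clifford) : Op n :=
  (cliffordOp C)ᴴ * pauliOp P * cliffordOp C

theorem rotated_apply (P : PauliString n) (C : Fin n → Clifford) (x y : Fin n → Fin 2) :
    rotated P C x y =
      ∏ i, ((cliffordMat (C i))ᴴ * (P i).mat * cliffordMat (C i)) (x i) (y i) := by
  simp only [rotated, cliffordOp, conjTranspose_tensor, pauliOp, tensor_mul]
  rfl

theorem cliffordMat_unitary (c : Clifford) : (cliffordMat c)ᴴ * cliffordMat c = 1 := by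
  change (cosetRep c.1 * c.2.mat)ᴴ * (cosetRep c.1 * c.2.mat) = 1
  rw [Matrix.conjTranspose_mul, Matrix.mul_assoc, ← Matrix.mul_assoc (cosetRep c.1)ᴴ,
    cosetRep_unitary, Matrix.one_mul, Pauli.conjTranspose_mat, Pauli.mat_mul_self]

theorem cliffordOp_unitary (C : Fin n → Clifford) : (cliffordOp C)ᴴ * cliffordOp C = 1 := by
  simp [cliffordOp, conjTranspose_tensor, tensor_mul, cliffordMat_unitary, tensor_one]

theorem conj_basisProj_apply (C : Fin n → Clifford) (a b : Fin n → Fin 2) :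
    conjBy (cliffordOp C) (basisProj 0) a b = cliffordOp C a 0 * star (cliffordOp C b 0) := by
  rw [conjBy_apply, basisProj, Matrix.mul_apply]
  simp [Matrix.mul_apply, Matrix.single_apply, ite_and]

/-- Averaging the prepared states and the measured effects over the Clifford layer. -/
theorem sum_clifford_layer (P : PauliString n) (d e : Fin n → Fin 2) :
    ∑ C : Fin n → Clifford, ∑ x : Fin n → Fin 2,
      ((3 : ℂ) ^ weight P * (rotated P C x x * rotated P C 0 0) *
        (star (cliffordOp C d x) * cliffordOp C e x)) • conjBy (cliffordOp C) (basisProj 0) =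
      (12 ^ n * pauliOp P e d) • pauliOp P := by
  ext a b
  simp only [Matrix.sum_apply, Matrix.smul_apply, conj_basisProj_apply, smul_eq_mul]
  simp only [pow_weight, rotated_apply, cliffordOp, tensor, pauliOp, Matrix.of_apply, star_prod,
    ← Finset.prod_mul_distrib]
  have h : (12 : ℂ) ^ n * (∏ i, (P i).mat (e i) (d i)) * ∏ i, (P i).mat (a i) (b i) =
      ∏ i, 12 * ((P i).mat (a i) (b i) * (P i).mat (e i) (d i)) := by
    simp only [Finset.prod_mul_distrib]
    simp
    ring
  rw [h]
  simp only [← sum_cliffordMat]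
  rw [Fintype.prod_sum]
  refine Finset.sum_congr rfl fun C _ => ?_
  rw [Fintype.prod_sum]
  refine Finset.sum_congr rfl fun x _ => Finset.prod_congr rfl fun i _ => ?_
  simp only [Pi.zero_apply]
  ring

end CliffordAverage

end CliffordTwirl

/-! ### Outcome probabilities and the mean of `Ω_P` -/

section Expectation

open scoped ComplexOrder

variable {n : ℕ}

/-! ### Positivity and trace preservation -/

theorem posSemidef_conjBy (A : Op n) {X : Op n} (hX : X.PosSemidef) :
    (conjBy A X).PosSemidef := by
  rw [conjBy_apply]
  exact hX.mul_mul_conjTranspose_same A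

theorem IsChannel.posSemidef {Φ : Op n →ₗ[ℂ] Op n} (hΦ : IsChannel Φ) {X : Op n}
    (hX : X.PosSemidef) : (Φ X).PosSemidef := by
  obtain ⟨m, A, -, rfl⟩ := hΦ
  rw [LinearMap.sum_apply]
  exact Matrix.posSemidef_sum _ fun k _ => posSemidef_conjBy _ hX

theorem IsChannel.trace_apply {Φ : Op n →ₗ[ℂ] Op n} (hΦ : IsChannel Φ) (X : Op n) :
    trace (Φ X) = trace X := by
  obtain ⟨m, A, hA, rfl⟩ := hΦ
  have h : ∀ k, trace (conjBy (A k) X) = trace ((A k)ᴴ * A k * X) := fun k => by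
    rw [conjBy_apply, Matrix.trace_mul_comm, Matrix.mul_assoc]
  simp only [LinearMap.sum_apply, Matrix.trace_sum, h]
  rw [← Matrix.trace_sum, ← Finset.sum_mul, hA, Matrix.one_mul]

theorem posSemidef_pauliChannel {μ : PauliString n → ℝ} (hμ : ∀ P, 0 ≤ μ P) {X : Op n}
    (hX : X.PosSemidef) : (pauliChannel μ X).PosSemidef := by
  rw [pauliChannel, LinearMap.sum_apply]
  refine Matrix.posSemidef_sum _ fun P _ => ?_
  exact (posSemidef_conjBy (pauliOp P) hX).smul (by exact_mod_cast hμ P)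

theorem posSemidef_pauliChannel_pow {μ : PauliString n → ℝ} (hμ : ∀ P, 0 ≤ μ P) (k : ℕ)
    {X : Op n} (hX : X.PosSemidef) : ((pauliChannel μ ^ k) X).PosSemidef := by
  induction k with
  | zero => simpa using hX
  | succ k ih =>
    rw [pow_succ', Module.End.mul_apply]
    exact posSemidef_pauliChannel hμ ih

theorem posSemidef_basisProj (x : Fin n → Fin 2) : (basisProj x).PosSemidef := by
  have h : basisProj x = basisProj x * (basisProj x)ᴴ := by
    simp [basisProj]
  rw [h]
  exact Matrix.posSemidef_self_mul_conjTranspose _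

theorem posSemidef_preMeasurement {μ : PauliString n → ℝ} (hμ : ∀ P, 0 ≤ μ P)
    {Φ₁ Φ₂ : Op n →ₗ[ℂ] Op n} (h₁ : IsChannel Φ₁) (h₂ : IsChannel Φ₂) (k : ℕ)
    (C : Fin n → Clifford) (Qin Qout : PauliString n) :
    (preMeasurement μ Φ₁ Φ₂ k C Qin Qout).PosSemidef :=
  h₂.posSemidef (posSemidef_conjBy _ (posSemidef_pauliChannel_pow hμ k
    (posSemidef_conjBy _ (h₁.posSemidef (posSemidef_conjBy _ (posSemidef_basisProj 0))))))

/-- The diagonal matrix element whose real part is the outcome probability. -/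
theorem outcome_nonneg {μ : PauliString n → ℝ} (hμ : ∀ P, 0 ≤ μ P)
    {Φ₁ Φ₂ : Op n →ₗ[ℂ] Op n} (h₁ : IsChannel Φ₁) (h₂ : IsChannel Φ₂) (k : ℕ) (C : Fin n → Clifford)
    (Qin Qout : PauliString n) (x : Fin n → Fin 2) :
    0 ≤ ((cliffordOp C)ᴴ * preMeasurement μ Φ₁ Φ₂ k C Qin Qout * cliffordOp C) x x :=
  ((posSemidef_preMeasurement hμ h₁ h₂ k C Qin Qout).conjTranspose_mul_mul_same _).diag_nonneg

theorem runProb_nonneg {μ : PauliString n → ℝ} (hμ : ∀ P, 0 ≤ μ P)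
    {Φ₁ Φ₂ : Op n →ₗ[ℂ] Op n} (h₁ : IsChannel Φ₁) (h₂ : IsChannel Φ₂) (k : ℕ) (ω : Record n) :
    0 ≤ runProb μ Φ₁ Φ₂ k ω :=
  mul_nonneg (by positivity) (Complex.nonneg_iff.1 (outcome_nonneg hμ h₁ h₂ k _ _ _ _)).1

/-- The diagonal entry is non-negative by positivity of the channels, so taking its real part loses
nothing and the expectation can be computed over `ℂ`. -/
theorem ofReal_runProb {μ : PauliString n → ℝ} (hμ : ∀ P, 0 ≤ μ P)
    {Φ₁ Φ₂ : Op n →ₗ[ℂ] Op n} (h₁ : IsChannel Φ₁) (h₂ : IsChannel Φ₂) (k : ℕ) (ω : Record n) :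
    ((runProb μ Φ₁ Φ₂ k ω : ℝ) : ℂ) = ((24 : ℂ) ^ n * 4 ^ n * 4 ^ n)⁻¹ *
      ((cliffordOp ω.clifford)ᴴ * preMeasurement μ Φ₁ Φ₂ k ω.clifford ω.qin ω.qout *
        cliffordOp ω.clifford) ω.outcome ω.outcome := by
  rw [runProb, Complex.ofReal_mul]
  congr 1
  · push_cast
    rfl
  · exact Complex.ext rfl
      (Complex.nonneg_iff.1 (outcome_nonneg hμ h₁ h₂ k ω.clifford ω.qin ω.qout ω.outcome)).2

/-! ### The random variables `Ω` -/

theorem isHermitian_rotated (P : PauliString n) (C : Fin n → Clifford) :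
    (rotated P C).IsHermitian := by
  rw [Matrix.IsHermitian, rotated]
  simp only [Matrix.conjTranspose_mul, Matrix.conjTranspose_conjTranspose, conjTranspose_pauliOp,
    Matrix.mul_assoc]

theorem ofReal_re_rotated (P : PauliString n) (C : Fin n → Clifford) (x : Fin n → Fin 2) :
    (((rotated P C x x).re : ℝ) : ℂ) = rotated P C x x :=
  Complex.conj_eq_iff_re.1 ((isHermitian_rotated P C).apply x x)

theorem shadow_eq (P : PauliString n) (ω : Record n) :
    shadow P ω = 3 ^ weight P * (rotated P ω.clifford ω.outcome ω.outcome).re *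
      (rotated P ω.clifford 0 0).re * chi P ω.qin * chi P ω.qout := rfl

theorem abs_re_rotated_le (P : PauliString n) (C : Fin n → Clifford) (x : Fin n → Fin 2) :
    |(rotated P C x x).re| ≤ 1 := by
  refine (Complex.abs_re_le_norm _).trans (entry_norm_bound_of_unitary ?_ x x)
  rw [Matrix.mem_unitaryGroup_iff', Matrix.star_eq_conjTranspose, isHermitian_rotated]
  have h : cliffordOp C * (cliffordOp C)ᴴ = 1 := mul_eq_one_comm.1 (cliffordOp_unitary C)
  calc rotated P C * rotated P C = (cliffordOp C)ᴴ * pauliOp P *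
        (cliffordOp C * (cliffordOp C)ᴴ) * (pauliOp P * cliffordOp C) := by
        simp only [rotated, Matrix.mul_assoc]
    _ = 1 := by
      rw [h, Matrix.mul_one, Matrix.mul_assoc, ← Matrix.mul_assoc (pauliOp P), pauliOp_mul_self,
        Matrix.one_mul, cliffordOp_unitary]

theorem abs_shadow_le (P : PauliString n) (ω : Record n) : |shadow P ω| ≤ 3 ^ weight P := by
  rw [shadow_eq]
  simp only [abs_mul, abs_chi, mul_one, abs_pow]
  rw [mul_assoc, abs_of_nonneg (by norm_num : (0 : ℝ) ≤ 3)]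
  exact mul_le_of_le_one_right (by positivity)
    (mul_le_one₀ (abs_re_rotated_le _ _ _) (abs_nonneg _) (abs_re_rotated_le _ _ _))

theorem weight_extend_le {A : Finset (Fin n)} (P : A → Pauli) : weight (extend P) ≤ A.card :=
  Finset.card_le_card fun _ hi => (extend_ne (Finset.mem_filter.1 hi).2).1

/-- A record is a Clifford layer, two Pauli layers and an outcome. -/
def recordEquiv : Record n ≃
    (Fin n → Clifford) × (Fin n → Fin 2) × PauliString n × PauliString n where
  toFun ω := (ω.clifford, ω.outcome, ω.qin, ω.qout)
  invFun t := ⟨t.1, t.2.2.1, t.2.2.2, t.2.1⟩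
  left_inv _ := rfl
  right_inv _ := rfl

theorem sum_record {M : Type*} [AddCommMonoid M] (F : Record n → M) :
    ∑ ω, F ω = ∑ C, ∑ x, ∑ Qin, ∑ Qout, F ⟨C, Qin, Qout, x⟩ := by
  rw [← Equiv.sum_comp recordEquiv.symm]
  simp only [Fintype.sum_prod_type]
  rfl

theorem trace_pauliOp_mul_self (P : PauliString n) : trace (pauliOp P * pauliOp P) = 2 ^ n := by
  rw [pauliOp_mul_self]
  simp [Matrix.trace_one]

/-- Averaging over the two Pauli layers projects on the mode `P`. -/
theorem sum_preMeasurement (μ : PauliString n → ℝ) (Φ₁ Φ₂ : Op n →ₗ[ℂ] Op n) (k : ℕ)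
    (C : Fin n → Clifford) (P : PauliString n) :
    ∑ Qin, ∑ Qout, (((chi P Qin : ℝ) : ℂ) * ((chi P Qout : ℝ) : ℂ)) •
        preMeasurement μ Φ₁ Φ₂ k C Qin Qout =
      (8 ^ n * ((eigenvalue μ P : ℝ) : ℂ) ^ k *
        trace (pauliOp P * Φ₁ (conjBy (cliffordOp C) (basisProj 0)))) • Φ₂ (pauliOp P) := by
  have h : ∀ X : Op n, ∑ Qin, ∑ Qout, (((chi P Qin : ℝ) : ℂ) * ((chi P Qout : ℝ) : ℂ)) •
        Φ₂ (conjBy (pauliOp Qout) ((pauliChannel μ ^ k) (conjBy (pauliOp Qin) X))) =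
      Φ₂ (∑ Qout, ((chi P Qout : ℝ) : ℂ) • conjBy (pauliOp Qout) ((pauliChannel μ ^ k)
        (∑ Qin, ((chi P Qin : ℝ) : ℂ) • conjBy (pauliOp Qin) X))) := by
    intro X
    simp only [map_sum, map_smul, Finset.smul_sum, smul_smul]
    rw [Finset.sum_comm]
    simp only [mul_comm]
  simp only [preMeasurement]
  rw [h, sum_chi_smul_conjBy, map_smul, sum_chi_smul_conjBy, map_smul, pauliChannel_pow_pauliOp,
    Matrix.mul_smul, Matrix.mul_smul, Matrix.trace_smul, Matrix.trace_smul, trace_pauliOp_mul_self]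
  congr 1
  simp only [smul_eq_mul]
  rw [show (8 : ℂ) = 2 * 2 * 2 by norm_num, mul_pow, mul_pow]
  ring

theorem conj_entry (U X : Op n) (x : Fin n → Fin 2) :
    (Uᴴ * X * U) x x = ∑ e, ∑ d, star (U d x) * U e x * X d e := by
  simp only [Matrix.mul_apply, Matrix.conjTranspose_apply, Finset.sum_mul]
  exact Finset.sum_congr rfl fun e _ => Finset.sum_congr rfl fun d _ => by ring

/-- The expectation of `Ω_P` in a run with `k` uses of the channel. -/
theorem expectation_shadow {μ : PauliString n → ℝ} (hμ : ∀ P, 0 ≤ μ P)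
    {Φ₁ Φ₂ : Op n →ₗ[ℂ] Op n} (h₁ : IsChannel Φ₁) (h₂ : IsChannel Φ₂) (k : ℕ)
    (P : PauliString n) :
    ((∑ ω, runProb μ Φ₁ Φ₂ k ω * shadow P ω : ℝ) : ℂ) =
      ((4 : ℂ) ^ n)⁻¹ * (trace (pauliOp P * Φ₁ (pauliOp P)) * trace (pauliOp P * Φ₂ (pauliOp P))) *
        ((eigenvalue μ P : ℝ) : ℂ) ^ k := by
  set α := ((eigenvalue μ P : ℝ) : ℂ) ^ k with hα
  set κ : ℂ := ((24 : ℂ) ^ n * 4 ^ n * 4 ^ n)⁻¹ with hκ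
  let L : Op n →ₗ[ℂ] ℂ :=
    Matrix.traceLinearMap (Fin n → Fin 2) ℂ ℂ ∘ₗ LinearMap.mulLeft ℂ (pauliOp P) ∘ₗ Φ₁
  have hL : ∀ X, L X = trace (pauliOp P * Φ₁ X) := fun X => rfl
  let f : (Fin n → Clifford) → (Fin n → Fin 2) → ℂ := fun C x =>
    (3 : ℂ) ^ weight P * (rotated P C x x * rotated P C 0 0)
  have hC : ∀ C x, ∑ Qin, ∑ Qout, ((runProb μ Φ₁ Φ₂ k ⟨C, Qin, Qout, x⟩ *
      shadow P ⟨C, Qin, Qout, x⟩ : ℝ) : ℂ) =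
      κ * 8 ^ n * α * ∑ e, ∑ d, L ((f C x * (star (cliffordOp C d x) * cliffordOp C e x)) •
        conjBy (cliffordOp C) (basisProj 0)) * Φ₂ (pauliOp P) d e := by
    intro C x
    have h1 : ∀ Qin Qout, ((runProb μ Φ₁ Φ₂ k ⟨C, Qin, Qout, x⟩ *
        shadow P ⟨C, Qin, Qout, x⟩ : ℝ) : ℂ) = κ * f C x * ((cliffordOp C)ᴴ *
          ((((chi P Qin : ℝ) : ℂ) * ((chi P Qout : ℝ) : ℂ)) •
            preMeasurement μ Φ₁ Φ₂ k C Qin Qout) * cliffordOp C) x x := by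
      intro Qin Qout
      rw [Complex.ofReal_mul, ofReal_runProb hμ h₁ h₂, shadow_eq]
      simp only [Complex.ofReal_mul, ofReal_re_rotated, Matrix.mul_smul, Matrix.smul_mul,
        Matrix.smul_apply, smul_eq_mul, Complex.ofReal_pow, Complex.ofReal_ofNat, f]
      ring
    simp only [h1, ← Finset.mul_sum, ← Matrix.sum_apply, ← Finset.sum_mul]
    rw [sum_preMeasurement, conj_entry, ← hL]
    simp only [map_smul, smul_eq_mul, Matrix.smul_apply, Finset.mul_sum, ← hα]
    refine Finset.sum_congr rfl fun e _ => Finset.sum_congr rfl fun d _ => ?_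
    ring
  rw [sum_record]
  simp only [Complex.ofReal_sum, hC, ← Finset.mul_sum]
  -- With the entries `d`, `e` of the measured operator fixed, the sum over `C` and `x` moves inside
  -- the linear functional `L`, where `sum_clifford_layer` applies.
  have hswap : ∑ C, ∑ x, ∑ e, ∑ d,
      L ((f C x * (star (cliffordOp C d x) * cliffordOp C e x)) •
        conjBy (cliffordOp C) (basisProj 0)) * Φ₂ (pauliOp P) d e =
      ∑ e, ∑ d, L (∑ C, ∑ x, (f C x * (star (cliffordOp C d x) * cliffordOp C e x)) •
        conjBy (cliffordOp C) (basisProj 0)) * Φ₂ (pauliOp P) d e := by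
    simp only [map_sum, Finset.sum_mul]
    calc _ = ∑ C, ∑ e, ∑ x, ∑ d, _ := Finset.sum_congr rfl fun C _ => Finset.sum_comm
      _ = ∑ e, ∑ C, ∑ x, ∑ d, _ := Finset.sum_comm
      _ = ∑ e, ∑ C, ∑ d, ∑ x, _ := Finset.sum_congr rfl fun e _ =>
          Finset.sum_congr rfl fun C _ => Finset.sum_comm
      _ = _ := Finset.sum_congr rfl fun e _ => Finset.sum_comm
  rw [hswap]
  simp only [f, sum_clifford_layer, map_smul, smul_eq_mul]
  have htr : trace (pauliOp P * Φ₂ (pauliOp P)) =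
      ∑ e, ∑ d, pauliOp P e d * Φ₂ (pauliOp P) d e := rfl
  rw [htr, ← hL]
  -- `8` comes from the two Pauli twirls and `tr(P P)`, `12` from the Clifford average: `8 * 12 /
  -- (24 * 4 * 4) = 1 / 4` per qubit.
  have hκ' : κ * 8 ^ n * 12 ^ n = ((4 : ℂ) ^ n)⁻¹ := by
    rw [hκ, ← mul_pow, ← mul_pow, ← inv_pow, ← mul_pow, ← mul_pow, ← inv_pow]
    norm_num
  rw [← hκ']
  simp only [Finset.mul_sum, Finset.sum_mul]
  refine Finset.sum_congr rfl fun e _ => Finset.sum_congr rfl fun d _ => ?_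
  ring

theorem eigenvalue_idString (μ : PauliString n → ℝ) : eigenvalue μ (idString n) = ∑ P, μ P := by
  simp [eigenvalue, chi, idString, Pauli.sign]

theorem shadow_idString (ω : Record n) : shadow (idString n) ω = 1 := by
  have h : rotated (idString n) ω.clifford = 1 := by
    rw [rotated, pauliOp_idString, Matrix.mul_one, cliffordOp_unitary]
  rw [shadow_eq, h]
  simp [weight, chi, idString, Pauli.sign]

theorem trace_one_op : trace (1 : Op n) = 2 ^ n := by
  simp [Matrix.trace_one]

/-- For the identity string `Ω` is identically `1`, so the total probability is an instance of the
expectation formula, evaluated by trace preservation. -/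
theorem sum_runProb {μ : PauliString n → ℝ} (hμ : ∀ P, 0 ≤ μ P) (hμ1 : ∑ P, μ P = 1)
    {Φ₁ Φ₂ : Op n →ₗ[ℂ] Op n} (h₁ : IsChannel Φ₁) (h₂ : IsChannel Φ₂) (k : ℕ) :
    ∑ ω, runProb μ Φ₁ Φ₂ k ω = 1 := by
  have h := expectation_shadow hμ h₁ h₂ k (idString n)
  simp only [shadow_idString, mul_one, eigenvalue_idString, hμ1, pauliOp_idString, Matrix.one_mul,
    h₁.trace_apply, h₂.trace_apply, trace_one_op] at h
  rw [← mul_pow, ← inv_pow, ← mul_pow] at h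
  norm_num at h
  exact_mod_cast h

theorem norm_trace_hsDual_mul (Φ : Op n →ₗ[ℂ] Op n) (P : PauliString n) :
    ‖trace (hsDual Φ (pauliOp P) * pauliOp P)‖ = ‖trace (pauliOp P * Φ (pauliOp P))‖ := by
  have h := trace_hsDual Φ (pauliOp P) (pauliOp P)
  rw [conjTranspose_pauliOp] at h
  rw [← h, ← norm_star, ← Matrix.trace_conjTranspose, Matrix.conjTranspose_mul,
    conjTranspose_pauliOp, Matrix.trace_mul_comm]

theorem spamFactor_eq (Φ₁ Φ₂ : Op n →ₗ[ℂ] Op n) (P : PauliString n) :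
    spamFactor Φ₁ Φ₂ P = ((4 : ℝ) ^ n)⁻¹ *
      (‖trace (pauliOp P * Φ₁ (pauliOp P))‖ * ‖trace (pauliOp P * Φ₂ (pauliOp P))‖) := by
  rw [spamFactor, norm_mul, norm_trace_hsDual_mul, norm_trace_hsDual_mul, pow_mul]
  norm_num

/-- This forces `C_SPAM ≤ 1` as soon as there is a hyperedge. -/
theorem spamFactor_idString {Φ₁ Φ₂ : Op n →ₗ[ℂ] Op n} (h₁ : IsChannel Φ₁) (h₂ : IsChannel Φ₂) :
    spamFactor Φ₁ Φ₂ (idString n) = 1 := by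
  rw [spamFactor_eq, pauliOp_idString, Matrix.one_mul, Matrix.one_mul, h₁.trace_apply,
    h₂.trace_apply, trace_one_op, norm_pow, ← mul_pow, ← inv_pow, ← mul_pow]
  norm_num

/-- The mean of `Ω_P` in a run without use of the channel has modulus the SPAM factor, and each use
of the channel multiplies the mean by the eigenvalue. -/
theorem abs_expectation_zero {μ : PauliString n → ℝ} (hμ : ∀ P, 0 ≤ μ P)
    {Φ₁ Φ₂ : Op n →ₗ[ℂ] Op n} (h₁ : IsChannel Φ₁) (h₂ : IsChannel Φ₂) (P : PauliString n) :
    |∑ ω, runProb μ Φ₁ Φ₂ 0 ω * shadow P ω| = spamFactor Φ₁ Φ₂ P := by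
  rw [← Real.norm_eq_abs, ← Complex.norm_real, expectation_shadow hμ h₁ h₂, pow_zero, mul_one,
    norm_mul, norm_mul, spamFactor_eq]
  simp

theorem expectation_one {μ : PauliString n → ℝ} (hμ : ∀ P, 0 ≤ μ P)
    {Φ₁ Φ₂ : Op n →ₗ[ℂ] Op n} (h₁ : IsChannel Φ₁) (h₂ : IsChannel Φ₂) (P : PauliString n) :
    ∑ ω, runProb μ Φ₁ Φ₂ 1 ω * shadow P ω =
      (∑ ω, runProb μ Φ₁ Φ₂ 0 ω * shadow P ω) * eigenvalue μ P := by
  apply Complex.ofReal_injective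
  rw [Complex.ofReal_mul, expectation_shadow hμ h₁ h₂, expectation_shadow hμ h₁ h₂, pow_zero,
    mul_one, pow_one]

end Expectation

/-! ### Hoeffding's inequality for finite product distributions -/

section Hoeffding

/-! ### Concentration of sums of independent bounded variables -/

section Concentration

variable {ι Ω : Type} [Fintype ι] [DecidableEq ι] [Fintype Ω]

open Classical in
/-- The probability of an event under a product of finite distributions. -/
noncomputable def productProb (p : ι → Ω → ℝ) (E : (ι → Ω) → Prop) : ℝ :=
  ∑ d : ι → Ω, if E d then ∏ j, p j (d j) else 0

theorem productProb_le_add {p : ι → Ω → ℝ} (hp : ∀ j ω, 0 ≤ p j ω) {E F G : (ι → Ω) → Prop}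
    (h : ∀ d, E d → F d ∨ G d) : productProb p E ≤ productProb p F + productProb p G := by
  rw [productProb, productProb, productProb, ← Finset.sum_add_distrib]
  refine Finset.sum_le_sum fun d _ => ?_
  have h0 : 0 ≤ ∏ j, p j (d j) := Finset.prod_nonneg fun j _ => hp j _
  by_cases hE : E d
  · rcases h d hE with hF | hG
    · rw [if_pos hE, if_pos hF]
      split_ifs <;> linarith
    · rw [if_pos hE, if_pos hG]
      split_ifs <;> linarith
  · rw [if_neg hE]
    split_ifs <;> linarith

theorem productProb_le_sum {κ : Type*} {p : ι → Ω → ℝ} (hp : ∀ j ω, 0 ≤ p j ω)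
    (s : Finset κ) {E : (ι → Ω) → Prop} {F : κ → (ι → Ω) → Prop}
    (h : ∀ d, E d → ∃ i ∈ s, F i d) : productProb p E ≤ ∑ i ∈ s, productProb p (F i) := by
  classical
  induction s using Finset.induction_on generalizing E with
  | empty =>
    rw [Finset.sum_empty, productProb]
    refine (Finset.sum_eq_zero fun d _ => if_neg fun hE => ?_).le
    obtain ⟨i, hi, -⟩ := h d hE
    simp at hi
  | insert a s ha ih =>
    rw [Finset.sum_insert ha]
    refine (productProb_le_add hp (F := F a) (G := fun d => ∃ i ∈ s, F i d) fun d hE => ?_).trans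
      (add_le_add_right (ih fun d hd => hd) _)
    obtain ⟨i, hi, hF⟩ := h d hE
    rcases Finset.mem_insert.1 hi with rfl | hi
    · exact Or.inl hF
    · exact Or.inr ⟨i, hi, hF⟩

theorem one_sub_productProb_not_le {p : ι → Ω → ℝ} (hp1 : ∀ j, ∑ ω, p j ω = 1)
    (E : (ι → Ω) → Prop) : 1 - productProb p (fun d => ¬ E d) = productProb p E := by
  have h : ∑ d : ι → Ω, ∏ j, p j (d j) = 1 := by
    rw [← Fintype.prod_sum]
    simp [hp1]
  rw [← h, productProb, productProb, ← Finset.sum_sub_distrib]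
  refine Finset.sum_congr rfl fun d _ => ?_
  by_cases hE : E d <;> simp [hE]

/-- Hoeffding's lemma: by convexity the exponential lies below its chord `cosh + x sinh` on `[-1,
1]`, the mean kills the `sinh` term, and `cosh u ≤ exp (u ^ 2 / 2)`. -/
theorem sum_mul_exp_le {p : Ω → ℝ} (hp : ∀ ω, 0 ≤ p ω) (hp1 : ∑ ω, p ω = 1) {X : Ω → ℝ} {b : ℝ}
    (hb : 0 < b) (hX : ∀ ω, |X ω| ≤ b) (hmean : ∑ ω, p ω * X ω = 0) (t : ℝ) :
    ∑ ω, p ω * Real.exp (t * X ω) ≤ Real.exp ((t * b) ^ 2 / 2) := by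
  refine le_trans ?_ (Real.cosh_le_exp_half_sq (t * b))
  calc ∑ ω, p ω * Real.exp (t * X ω)
      ≤ ∑ ω, p ω * (Real.cosh (t * b) + X ω / b * Real.sinh (t * b)) := by
        refine Finset.sum_le_sum fun ω _ => mul_le_mul_of_nonneg_left ?_ (hp ω)
        have h1 : |X ω / b| ≤ 1 := by
          rw [abs_div, abs_of_pos hb, div_le_one hb]
          exact hX ω
        have h2 := Real.exp_mul_le_cosh_add_mul_sinh h1 (t * b)
        rwa [show X ω / b * (t * b) = t * X ω by field_simp] at h2
    _ = (∑ ω, p ω) * Real.cosh (t * b) + (∑ ω, p ω * X ω) * (Real.sinh (t * b) / b) := by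
        rw [Finset.sum_mul, Finset.sum_mul, ← Finset.sum_add_distrib]
        exact Finset.sum_congr rfl fun ω _ => by ring
    _ = Real.cosh (t * b) := by rw [hp1, hmean]; ring

/-- The Chernoff-Hoeffding bound for centred variables. -/
theorem productProb_sum_ge_le {p : ι → Ω → ℝ} (hp : ∀ j ω, 0 ≤ p j ω)
    (hp1 : ∀ j, ∑ ω, p j ω = 1) (J : Finset ι) {X : Ω → ℝ} {b τ : ℝ} (hb : 0 < b) (hτ : 0 ≤ τ)
    (hX : ∀ ω, |X ω| ≤ b) (hmean : ∀ j ∈ J, ∑ ω, p j ω * X ω = 0) :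
    productProb p (fun d => J.card * τ ≤ ∑ j ∈ J, X (d j)) ≤
      Real.exp (-(J.card * τ ^ 2 / (2 * b ^ 2))) := by
  -- The minimizer of `-t τ + (t b)² / 2`. Runs outside `J` contribute the factor `1`.
  set t := τ / b ^ 2 with ht
  have ht0 : 0 ≤ t := by positivity
  calc productProb p (fun d => J.card * τ ≤ ∑ j ∈ J, X (d j))
      ≤ ∑ d : ι → Ω, Real.exp (-(t * (J.card * τ))) *
          ∏ j, p j (d j) * if j ∈ J then Real.exp (t * X (d j)) else 1 := by
        refine Finset.sum_le_sum fun d _ => ?_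
        have h0 : 0 ≤ ∏ j, p j (d j) := Finset.prod_nonneg fun j _ => hp j _
        rw [Finset.prod_mul_distrib, Finset.prod_ite_mem, Finset.univ_inter, ← Real.exp_sum,
          mul_left_comm, ← Real.exp_add, ← Finset.mul_sum]
        split_ifs with h
        · refine le_mul_of_one_le_right h0 (Real.one_le_exp ?_)
          nlinarith
        · positivity
    _ = Real.exp (-(t * (J.card * τ))) *
          ∏ j, ∑ ω, p j ω * if j ∈ J then Real.exp (t * X ω) else 1 := by
        rw [← Finset.mul_sum, Fintype.prod_sum]
    _ ≤ Real.exp (-(t * (J.card * τ))) *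
          ∏ j, if j ∈ J then Real.exp ((t * b) ^ 2 / 2) else 1 := by
        refine mul_le_mul_of_nonneg_left (Finset.prod_le_prod (fun j _ => ?_) fun j _ => ?_)
          (Real.exp_pos _).le
        · refine Finset.sum_nonneg fun ω _ => mul_nonneg (hp j ω) ?_
          split_ifs <;> positivity
        · split_ifs with hj
          · exact sum_mul_exp_le (hp j) (hp1 j) hb hX (hmean j hj) t
          · simp [hp1]
    _ = Real.exp (-(J.card * τ ^ 2 / (2 * b ^ 2))) := by
        rw [Finset.prod_ite_mem, Finset.univ_inter, Finset.prod_const, ← Real.exp_nat_mul,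
          ← Real.exp_add, ht]
        congr 1
        field_simp
        ring

/-- Centring doubles the bound, so `2 * (2B)² = 8 * B²`; the factor `2` counts the two tails. -/
theorem productProb_abs_sum_sub_ge_le {p : ι → Ω → ℝ} (hp : ∀ j ω, 0 ≤ p j ω)
    (hp1 : ∀ j, ∑ ω, p j ω = 1) (J : Finset ι) {f : Ω → ℝ} {B τ e : ℝ} (hB : 0 < B) (hτ : 0 ≤ τ)
    (hf : ∀ ω, |f ω| ≤ B) (he : |e| ≤ B) (hmean : ∀ j ∈ J, ∑ ω, p j ω * f ω = e) :
    productProb p (fun d => J.card * τ ≤ |∑ j ∈ J, f (d j) - J.card * e|) ≤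
      2 * Real.exp (-(J.card * τ ^ 2 / (8 * B ^ 2))) := by
  have hbound : ∀ ω, |f ω - e| ≤ 2 * B := fun ω =>
    (abs_sub _ _).trans (by linarith [hf ω])
  have hm : ∀ j ∈ J, ∑ ω, p j ω * (f ω - e) = 0 := by
    intro j hj
    simp only [mul_sub, Finset.sum_sub_distrib, hmean j hj, ← Finset.sum_mul, hp1, one_mul, sub_self]
  have h1 := productProb_sum_ge_le hp hp1 J (by linarith : 0 < 2 * B) hτ hbound hm
  have h2 := productProb_sum_ge_le hp hp1 J (X := fun ω => -(f ω - e)) (by linarith : 0 < 2 * B) hτ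
    (fun ω => by rw [abs_neg]; exact hbound ω)
    (fun j hj => by simp only [mul_neg, Finset.sum_neg_distrib, hm j hj, neg_zero])
  have h3 : (2 : ℝ) * (2 * B) ^ 2 = 8 * B ^ 2 := by ring
  rw [h3] at h1 h2
  rw [two_mul (Real.exp _)]
  refine (productProb_le_add hp fun d hd => ?_).trans (add_le_add h1 h2)
  have hs : ∑ j ∈ J, (f (d j) - e) = ∑ j ∈ J, f (d j) - J.card * e := by
    rw [Finset.sum_sub_distrib, Finset.sum_const, nsmul_eq_mul]
  rw [Finset.sum_neg_distrib, hs]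
  exact le_abs.1 hd

theorem abs_sum_mul_le {p : Ω → ℝ} (hp : ∀ ω, 0 ≤ p ω) (hp1 : ∑ ω, p ω = 1) {f : Ω → ℝ} {B : ℝ}
    (hf : ∀ ω, |f ω| ≤ B) : |∑ ω, p ω * f ω| ≤ B := by
  refine (Finset.abs_sum_le_sum_abs _ _).trans ?_
  calc ∑ ω, |p ω * f ω| ≤ ∑ ω, p ω * B := Finset.sum_le_sum fun ω _ => by
        rw [abs_mul, abs_of_nonneg (hp ω)]
        exact mul_le_mul_of_nonneg_left (hf ω) (hp ω)
    _ = B := by rw [← Finset.sum_mul, hp1, one_mul]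

end Concentration

end Hoeffding

/-! ### Straight-line programs for the estimator -/

section RunTime

/-! ### The run time of the estimator -/

section Programs

variable {ι : Type}

theorem runProgram_append_singleton (x : ι → ℝ) (p : List (Instr ι)) (s : Instr ι) :
    runProgram x (p ++ [s]) = runProgram x p ++ [s.eval x (runProgram x p)] := by
  simp [runProgram, List.foldl_append]

theorem length_runProgram (x : ι → ℝ) (p : List (Instr ι)) :
    (runProgram x p).length = p.length := by
  induction p using List.reverseRecOn with
  | nil => rfl
  | append_singleton p s ih => simp [runProgram_append_singleton, ih]

/-- Registers are never overwritten, so results stay at their absolute addresses; this is what makes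
programs composable. -/
theorem getD_runProgram_append (x : ι → ℝ) (p q : List (Instr ι)) {i : ℕ} (hi : i < p.length) :
    (runProgram x (p ++ q)).getD i 0 = (runProgram x p).getD i 0 := by
  induction q using List.reverseRecOn with
  | nil => rw [List.append_nil]
  | append_singleton q s ih =>
    rw [← List.append_assoc, runProgram_append_singleton, List.getD_append, ih]
    rw [length_runProgram, List.length_append]
    omega

theorem getD_runProgram_last (x : ι → ℝ) (p : List (Instr ι)) (s : Instr ι) :
    (runProgram x (p ++ [s])).getD p.length 0 = s.eval x (runProgram x p) := by
  rw [runProgram_append_singleton, List.getD_append_right _ _ _ _ (length_runProgram x p).le,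
    length_runProgram]
  simp

/-- Any program can be continued by at most `t` steps so that some register holds `f x`. -/
def ComputesIn (f : (ι → ℝ) → ℝ) (t : ℕ) : Prop :=
  ∀ p : List (Instr ι), ∃ q : List (Instr ι), q.length ≤ t ∧
    ∃ i < (p ++ q).length, ∀ x, (runProgram x (p ++ q)).getD i 0 = f x

namespace ComputesIn

theorem mono {f : (ι → ℝ) → ℝ} {s t : ℕ} (hf : ComputesIn f s) (hst : s ≤ t) : ComputesIn f t :=
  fun p => (hf p).imp fun _ h => ⟨h.1.trans hst, h.2⟩

theorem of_instr (s : Instr ι) {f : (ι → ℝ) → ℝ} (hs : ∀ x regs, s.eval x regs = f x) :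
    ComputesIn f 1 := fun p =>
  ⟨[s], le_rfl, p.length, by simp, fun x => by rw [getD_runProgram_last, hs]⟩

theorem read (i : ι) : ComputesIn (fun x : ι → ℝ => x i) 1 := of_instr (.read i) fun _ _ => rfl

theorem const (q : ℚ) : ComputesIn (fun _ : ι → ℝ => (q : ℝ)) 1 :=
  of_instr (.const q) fun _ _ => rfl

theorem log {f : (ι → ℝ) → ℝ} {t : ℕ} (hf : ComputesIn f t) :
    ComputesIn (fun x => Real.log (f x)) (t + 1) := by
  intro p
  obtain ⟨q, hq, i, hi, hx⟩ := hf p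
  refine ⟨q ++ [.log i], by simpa using hq, (p ++ q).length, by simp, fun x => ?_⟩
  rw [← List.append_assoc, getD_runProgram_last, Instr.eval, hx]

theorem binary {f g h : (ι → ℝ) → ℝ} {s t : ℕ} (hf : ComputesIn f s) (hg : ComputesIn g t)
    (op : ℕ → ℕ → Instr ι)
    (hop : ∀ i j x regs, regs.getD i 0 = f x → regs.getD j 0 = g x → (op i j).eval x regs = h x) :
    ComputesIn h (s + t + 1) := by
  intro p
  obtain ⟨q, hq, i, hi, hx⟩ := hf p
  obtain ⟨q', hq', j, hj, hx'⟩ := hg (p ++ q)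
  refine ⟨q ++ q' ++ [op i j], by simp; omega, (p ++ q ++ q').length, by simp, fun x => ?_⟩
  rw [← List.append_assoc, ← List.append_assoc, getD_runProgram_last]
  exact hop i j x _ (by rw [getD_runProgram_append x _ _ hi, hx]) (hx' x)

theorem add {f g : (ι → ℝ) → ℝ} {s t : ℕ} (hf : ComputesIn f s) (hg : ComputesIn g t) :
    ComputesIn (fun x => f x + g x) (s + t + 1) :=
  hf.binary hg .add fun i j x regs hi hj => by rw [Instr.eval, hi, hj]

theorem mul {f g : (ι → ℝ) → ℝ} {s t : ℕ} (hf : ComputesIn f s) (hg : ComputesIn g t) :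
    ComputesIn (fun x => f x * g x) (s + t + 1) :=
  hf.binary hg .mul fun i j x regs hi hj => by rw [Instr.eval, hi, hj]

theorem const_mul (q : ℚ) {f : (ι → ℝ) → ℝ} {t : ℕ} (hf : ComputesIn f t) :
    ComputesIn (fun x => (q : ℝ) * f x) (t + 2) :=
  ((const q).mul hf).mono (by omega)

theorem sum {κ : Type*} (s : Finset κ) {m t : ℕ} (hm : s.card ≤ m) {f : κ → (ι → ℝ) → ℝ}
    (hf : ∀ k, ComputesIn (f k) t) : ComputesIn (fun x => ∑ k ∈ s, f k x) (m * (t + 1) + 1) := by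
  refine mono ?_ (Nat.add_le_add_right (Nat.mul_le_mul_right (t + 1) hm) 1)
  clear hm
  classical
  induction s using Finset.induction_on with
  | empty => simpa using const (ι := ι) 0
  | insert a s ha ih =>
    simp only [Finset.sum_insert ha, Finset.card_insert_of_notMem ha]
    exact ((hf a).add ih).mono (by ring_nf; omega)

/-- A finite family of functions can be computed by one program. -/
theorem family {κ : Type*} (s : Finset κ) {t : ℕ} {f : κ → (ι → ℝ) → ℝ}
    (hf : ∀ k, ComputesIn (f k) t) :
    ∃ (p : List (Instr ι)) (out : κ → ℕ), p.length ≤ s.card * t ∧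
      ∀ k ∈ s, out k < p.length ∧ ∀ x, (runProgram x p).getD (out k) 0 = f k x := by
  classical
  induction s using Finset.induction_on with
  | empty => exact ⟨[], fun _ => 0, by simp, by simp⟩
  | insert a s ha ih =>
    obtain ⟨p, out, hp, hout⟩ := ih
    obtain ⟨q, hq, i, hi, hx⟩ := hf a p
    refine ⟨p ++ q, Function.update out a i, ?_, fun k hk => ?_⟩
    · rw [Finset.card_insert_of_notMem ha, List.length_append, add_mul, one_mul]
      exact add_le_add hp hq
    · by_cases hka : k = a
      · subst hka
        simp only [Function.update_self]
        exact ⟨hi, hx⟩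
      · obtain ⟨h1, h2⟩ := hout k ((Finset.mem_insert.1 hk).resolve_left hka)
        rw [Function.update_of_ne hka]
        refine ⟨by rw [List.length_append]; omega, fun x => ?_⟩
        rw [getD_runProgram_append x _ _ h1, h2]

end ComputesIn

theorem exists_rat_eq_chi {α : Type} [Fintype α] (P Q : α → Pauli) :
    ∃ q : ℚ, (q : ℝ) = chi P Q := by
  refine ⟨∏ i, if P i = .I ∨ Q i = .I ∨ P i = Q i then 1 else -1, ?_⟩
  rw [Rat.cast_prod, chi]
  refine Finset.prod_congr rfl fun i _ => ?_
  rw [Pauli.sign]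
  split_ifs <;> simp

theorem ComputesIn.chi_mul {α : Type} [Fintype α] (P Q : α → Pauli) {f : (ι → ℝ) → ℝ} {t : ℕ}
    (hf : ComputesIn f t) : ComputesIn (fun x => chi P Q * f x) (t + 2) := by
  obtain ⟨q, hq⟩ := exists_rat_eq_chi P Q
  rw [← hq]
  exact hf.const_mul q

theorem ComputesIn.inv_pow_mul (k : ℕ) {f : (ι → ℝ) → ℝ} {t : ℕ}
    (hf : ComputesIn f t) : ComputesIn (fun x => ((4 : ℝ) ^ k)⁻¹ * f x) (t + 2) := by
  have h := hf.const_mul ((4 : ℚ) ^ k)⁻¹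
  push_cast at h
  exact h

variable {n : ℕ}

theorem card_strings_le {A : Finset (Fin n)} {k : ℕ} (hA : A.card ≤ k)
    (s : Finset (A → Pauli)) : s.card ≤ 4 ^ k := by
  refine (Finset.card_le_univ s).trans ?_
  simp only [Fintype.card_fun, Pauli.card_eq_four, Fintype.card_coe]
  exact Nat.pow_le_pow_right (by norm_num) hA

/-- The number of steps of the estimator on a region of size at most `k`. -/
def estimatorSteps (k : ℕ) : ℕ :=
  4 ^ k * (4 ^ k * (4 ^ k * (4 ^ k * 4 + 7) + 4) + 3)

theorem estimatorRunsIn (H : Finset (Finset (Fin n))) (h : Finset (Fin n)) {k : ℕ}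
    (hk : (region H h).card ≤ k) : EstimatorRunsIn H h (estimatorSteps k) := by
  have hk' : h.card ≤ k := (Finset.card_le_card (self_subset_region H h)).trans hk
  -- Step counts: a read costs `1`, a product with a constant `2`, a logarithm `1`, and a sum one
  -- addition per term plus the initial `0`. These nest to `estimatorSteps k`, whose outer `4 ^ k`
  -- counts the strings `Q` on `h`.
  have hm : ∀ Q' : region H h → Pauli, ComputesIn (fun x : (region H h → Pauli) → ℝ =>
      ((4 : ℝ) ^ (region H h).card)⁻¹ * ∑ P, chi P Q' * x P) (4 ^ k * 4 + 3) := fun Q' =>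
    (ComputesIn.sum univ (card_strings_le hk _) fun P =>
      (ComputesIn.read P).chi_mul P Q').inv_pow_mul _
  have hQ : ∀ Q : h → Pauli, ComputesIn (fun x : (region H h → Pauli) → ℝ =>
      ((4 : ℝ) ^ (region H h).card)⁻¹ * ∑ P ∈ ownModes H h, chi P Q *
        ∑ Q' : region H h → Pauli, chi (restrict (extend P) (region H h)) Q' *
          Real.log (((4 : ℝ) ^ (region H h).card)⁻¹ * ∑ P', chi P' Q' * x P'))
      (4 ^ k * (4 ^ k * (4 ^ k * 4 + 7) + 4) + 3) := fun Q =>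
    (ComputesIn.sum (ownModes H h) (card_strings_le hk' _) fun P =>
      (ComputesIn.sum univ (card_strings_le hk _) fun Q' =>
        ((hm Q').log.chi_mul _ Q')).chi_mul P Q).inv_pow_mul _
  obtain ⟨p, out, hp, hout⟩ := ComputesIn.family univ hQ
  exact ⟨p, out, hp.trans (Nat.mul_le_mul_right _ (card_strings_le hk' _)),
    fun a Q => (hout Q (mem_univ Q)).2 _⟩

end Programs

end RunTime

/-! ### The two protocols and their sample complexity -/

section Protocols

/-! ### The protocols -/

variable {n : ℕ}

/-- The protocol without runs, which returns the eigenvalues of the completely depolarizing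
channel. -/
noncomputable def depolarizingProtocol (H : Finset (Finset (Fin n))) : Protocol n where
  runs := 0
  uses := fun _ => 0
  fit := fun P _ => eigenvalue (gibbs H 0) P

/-- `N` runs without the channel and `N` runs with one use of it; an eigenvalue is estimated by the
ratio of the two empirical means, in which the SPAM factor cancels. -/
noncomputable def ratioProtocol (n N : ℕ) : Protocol n where
  runs := N + N
  uses := fun j => if j.1 < N then 0 else 1
  fit := fun _ v => (∑ j ∈ univ.filter (fun j : Fin (N + N) => ¬ j.1 < N), v j) /
    ∑ j ∈ univ.filter (fun j : Fin (N + N) => j.1 < N), v j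

theorem card_filter_lt (N : ℕ) : (univ.filter fun j : Fin (N + N) => j.1 < N).card = N := by
  rw [Fin.card_filter_val_lt]
  omega

theorem card_filter_not_lt (N : ℕ) : (univ.filter fun j : Fin (N + N) => ¬ j.1 < N).card = N := by
  have h := Finset.card_filter_add_card_filter_not (s := univ) fun j : Fin (N + N) => j.1 < N
  rw [card_filter_lt, Finset.card_univ, Fintype.card_fin] at h
  omega

theorem queries_ratioProtocol (N : ℕ) : (ratioProtocol n N).queries = N := by
  change ∑ j : Fin (N + N), (if j.1 < N then 0 else 1) = N
  rw [Finset.sum_ite, Finset.sum_const_zero, zero_add, Finset.sum_const, card_filter_not_lt]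
  simp

theorem prob_depolarizingProtocol (H : Finset (Finset (Fin n))) (μ : PauliString n → ℝ)
    (Φ₁ Φ₂ : Op n →ₗ[ℂ] Op n)
    {E : (Fin (depolarizingProtocol H).runs → Record n) → Prop} (hE : ∀ data, E data) :
    (depolarizingProtocol H).prob μ Φ₁ Φ₂ E = 1 := by
  have : IsEmpty (Fin (depolarizingProtocol H).runs) := inferInstanceAs (IsEmpty (Fin 0))
  simp only [Protocol.prob, hE, if_true]
  rw [Fintype.sum_unique, Finset.prod_of_isEmpty]

theorem normalized_zero (H : Finset (Finset (Fin n))) : Normalized H 0 :=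
  fun _ _ => ⟨by simp, fun _ _ _ _ => by simp⟩

/-- Quotients of approximate means. -/
theorem abs_div_sub_le {S₀ S₁ N s α C η : ℝ} (hN : 0 < N) (hC : 0 < C) (hη : 0 < η) (hη1 : η ≤ 1)
    (hs : C ≤ |s|) (hα : |α| ≤ 1) (h₀ : |S₀ - N * s| < N * (C * η / 4))
    (h₁ : |S₁ - N * (s * α)| < N * (C * η / 4)) : |S₁ / S₀ - α| ≤ η := by
  have hNC : 0 < N * C := mul_pos hN hC
  -- Since `η ≤ 1`, the deviation costs at most a quarter of `N * C`. The numerator error is at most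
  -- `N * C * η / 2`, so the quotient is off by at most `2η/3`.
  have hS₀ : N * C * (3 / 4) ≤ |S₀| := by
    have h2 : |N * s| ≤ |S₀| + |S₀ - N * s| := by
      have := abs_sub S₀ (S₀ - N * s)
      rwa [sub_sub_cancel] at this
    rw [abs_mul, abs_of_pos hN] at h2
    nlinarith [mul_le_mul_of_nonneg_left hs hN.le, mul_le_mul_of_nonneg_left hη1 hNC.le]
  have hpos : 0 < |S₀| := by linarith
  have hne : S₀ ≠ 0 := abs_pos.1 hpos
  rw [div_sub' hne, abs_div, div_le_iff₀ hpos]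
  have h3 : |S₁ - S₀ * α| ≤ N * (C * η / 4) + N * (C * η / 4) := by
    have h4 : S₁ - S₀ * α = (S₁ - N * (s * α)) - (S₀ - N * s) * α := by ring
    rw [h4]
    refine (abs_sub _ _).trans (add_le_add h₁.le ?_)
    rw [abs_mul]
    exact (mul_le_of_le_one_right (abs_nonneg _) hα).trans h₀.le
  nlinarith [mul_le_mul_of_nonneg_left hS₀ hη.le, mul_pos hNC hη]

/-- Union bound over the at most `|H| * 4^k` pairs of a hyperedge and a string on its region. Each
pair has two empirical means with two tails, whence the `4`. -/
theorem prob_ratioProtocol_ge {H : Finset (Finset (Fin n))} {μ : PauliString n → ℝ}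
    (hμ : ∀ P, 0 ≤ μ P) (hμ1 : ∑ P, μ P = 1) {Φ₁ Φ₂ : Op n →ₗ[ℂ] Op n} (hΦ₁ : IsChannel Φ₁)
    (hΦ₂ : IsChannel Φ₂) {C η : ℝ} (hC : 0 < C) (hη : 0 < η) (hη1 : η ≤ 1)
    (hspam : ∀ h ∈ H, ∀ P : region H h → Pauli, C ≤ spamFactor Φ₁ Φ₂ (extend P)) {k N : ℕ}
    (hk : ∀ h ∈ H, (region H h).card ≤ k) (hN : 0 < N)
    {E : (Fin (ratioProtocol n N).runs → Record n) → Prop}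
    (hE : ∀ data, (∀ h ∈ H, ∀ P : region H h → Pauli,
      |(ratioProtocol n N).eigenvalues data (extend P) - eigenvalue μ (extend P)| ≤ η) → E data) :
    1 - H.card * 4 ^ k * (4 * Real.exp (-(N * (C * η / 4) ^ 2 / (8 * (3 ^ k) ^ 2)))) ≤
      (ratioProtocol n N).prob μ Φ₁ Φ₂ E := by
  let p : Fin (N + N) → Record n → ℝ := fun j => runProb μ Φ₁ Φ₂ ((ratioProtocol n N).uses j)
  have hp : ∀ j ω, 0 ≤ p j ω := fun j ω => runProb_nonneg hμ hΦ₁ hΦ₂ _ ω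
  have hp1 : ∀ j, ∑ ω, p j ω = 1 := fun j => sum_runProb hμ hμ1 hΦ₁ hΦ₂ _
  have hN' : (0 : ℝ) < N := Nat.cast_pos.2 hN
  let mean : PauliString n → ℝ := fun P => ∑ ω, runProb μ Φ₁ Φ₂ 0 ω * shadow P ω
  let J₀ := univ.filter fun j : Fin (N + N) => j.1 < N
  let J₁ := univ.filter fun j : Fin (N + N) => ¬ j.1 < N
  have hmean₀ : ∀ P, ∀ j ∈ J₀, ∑ ω, p j ω * shadow P ω = mean P := by
    intro P j hj
    have hj' : (ratioProtocol n N).uses j = 0 := if_pos (Finset.mem_filter.1 hj).2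
    simp only [p, hj', mean]
  have hmean₁ : ∀ P, ∀ j ∈ J₁, ∑ ω, p j ω * shadow P ω = mean P * eigenvalue μ P := by
    intro P j hj
    have hj' : (ratioProtocol n N).uses j = 1 := if_neg (Finset.mem_filter.1 hj).2
    simp only [p, hj', mean]
    exact expectation_one hμ hΦ₁ hΦ₂ P
  let bad : (Σ h : Finset (Fin n), (region H h → Pauli)) → (Fin (N + N) → Record n) → Prop :=
    fun i d => N * (C * η / 4) ≤ |∑ j ∈ J₀, shadow (extend i.2) (d j) - N * mean (extend i.2)| ∨
      N * (C * η / 4) ≤ |∑ j ∈ J₁, shadow (extend i.2) (d j) -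
        N * (mean (extend i.2) * eigenvalue μ (extend i.2))|
  let s := H.sigma fun h => (univ : Finset (region H h → Pauli))
  have hbad : ∀ i ∈ s, productProb p (bad i) ≤
      4 * Real.exp (-(N * (C * η / 4) ^ 2 / (8 * (3 ^ k) ^ 2))) := by
    rintro ⟨h, P⟩ hi
    have hh : h ∈ H := (Finset.mem_sigma.1 hi).1
    have hB : ∀ ω : Record n, |shadow (extend P) ω| ≤ 3 ^ k := fun ω =>
      (abs_shadow_le _ ω).trans (pow_le_pow_right₀ (by norm_num)
        ((weight_extend_le P).trans (hk h hh)))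
    have hτ : 0 ≤ C * η / 4 := by positivity
    have hm : |mean (extend P)| ≤ 3 ^ k := abs_sum_mul_le
      (fun ω => runProb_nonneg hμ hΦ₁ hΦ₂ 0 ω) (sum_runProb hμ hμ1 hΦ₁ hΦ₂ 0) hB
    have hm' : |mean (extend P) * eigenvalue μ (extend P)| ≤ 3 ^ k := by
      rw [abs_mul]
      exact (mul_le_of_le_one_right (abs_nonneg _) (abs_eigenvalue_le hμ hμ1 _)).trans hm
    have h0 := productProb_abs_sum_sub_ge_le hp hp1 J₀ (by positivity) hτ hB hm (hmean₀ (extend P))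
    have h1 := productProb_abs_sum_sub_ge_le hp hp1 J₁ (by positivity) hτ hB hm' (hmean₁ (extend P))
    rw [card_filter_lt] at h0
    rw [card_filter_not_lt] at h1
    exact (productProb_le_add hp fun d hd => hd).trans ((add_le_add h0 h1).trans
      (le_of_eq (by ring)))
  have hcard : (s.card : ℝ) ≤ H.card * 4 ^ k := by
    rw [Finset.card_sigma]
    have : ∑ h ∈ H, (univ : Finset (region H h → Pauli)).card ≤ H.card * 4 ^ k := by
      rw [← smul_eq_mul]
      exact Finset.sum_le_card_nsmul _ _ _ fun h hh => card_strings_le (hk h hh) _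
    exact_mod_cast this
  have hfail : productProb p (fun d => ¬ E d) ≤
      H.card * 4 ^ k * (4 * Real.exp (-(N * (C * η / 4) ^ 2 / (8 * (3 ^ k) ^ 2)))) := by
    refine (productProb_le_sum hp s (F := bad) fun d hd => ?_).trans
      ((Finset.sum_le_card_nsmul _ _ _ hbad).trans ?_)
    · by_contra! hgood
      refine hd (hE d fun h hh P => ?_)
      obtain ⟨h0, h1⟩ := not_or.1 (hgood ⟨h, P⟩ (Finset.mem_sigma.2 ⟨hh, mem_univ P⟩))
      refine abs_div_sub_le hN' hC hη hη1 ?_ (abs_eigenvalue_le hμ hμ1 _) (not_le.1 h0)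
        (not_le.1 h1)
      rw [abs_expectation_zero hμ hΦ₁ hΦ₂]
      exact hspam h hh P
    · rw [nsmul_eq_mul]
      exact mul_le_mul_of_nonneg_right hcard (by positivity)
  have hprob : 1 - productProb p (fun d => ¬ E d) = (ratioProtocol n N).prob μ Φ₁ Φ₂ E :=
    one_sub_productProb_not_le hp1 E
  rw [← hprob]
  exact sub_le_sub_left hfail 1

/-- The accuracy of the eigenvalues that suffices for accuracy `ε` of the potentials. -/
noncomputable def eigenvalueAccuracy (r k m : ℕ) (β ε : ℝ) : ℝ :=
  min ε 1 * (((4 : ℝ) ^ k)⁻¹ * Real.exp (-(β * (m - 1) / 2))) / (2 * 4 ^ r)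

theorem eigenvalueAccuracy_pos (r k m : ℕ) (β : ℝ) {ε : ℝ} (hε : 0 < ε) :
    0 < eigenvalueAccuracy r k m β ε := by
  unfold eigenvalueAccuracy
  positivity

/-- The right side bounds the marginals below, so this is the validity condition of
`abs_log_sub_log_le`; it is the reason for `min ε 1` in place of `ε`. -/
theorem two_mul_eigenvalueAccuracy_le (r k m : ℕ) (β ε : ℝ) :
    2 * eigenvalueAccuracy r k m β ε ≤ ((4 : ℝ) ^ k)⁻¹ * Real.exp (-(β * (m - 1) / 2)) := by
  have h1 : min ε 1 ≤ 1 := min_le_right _ _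
  have h2 : (1 : ℝ) ≤ 4 ^ r := one_le_pow₀ (by norm_num)
  have h3 : 0 < ((4 : ℝ) ^ k)⁻¹ * Real.exp (-(β * (m - 1) / 2)) := by positivity
  rw [eigenvalueAccuracy, ← mul_div_assoc, mul_div_mul_left _ _ two_ne_zero,
    div_le_iff₀ (by positivity), mul_comm]
  exact mul_le_mul_of_nonneg_left (h1.trans h2) h3.le

/-- The estimator is exact at the true eigenvalues, so only stability is left: the logarithms move
by at most `2η/c = min ε 1 / 4^r`, and summing over own modes costs at most `4^r`. -/
theorem abs_potentialEstimator_sub_potential_le {H : Finset (Finset (Fin n))} {θ : Potentials n}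
    {r k m : ℕ} {β ε : ℝ} (hβ0 : 0 < β) (hε : 0 < ε) (hθ : Normalized H θ)
    (hβ : ∀ h ∈ H, ∀ Q, |θ h Q| ≤ β) {h : Finset (Fin n)} (hh : h ∈ H) (hr : h.card ≤ r)
    (hk : (region H h).card ≤ k)
    (hm : 4 * (H.filter fun h' => ¬ Disjoint h' (region H h)).card + 1 ≤ m)
    {a : PauliString n → ℝ}
    (ha : ∀ P : region H h → Pauli, |a (extend P) - eigenvalue (gibbs H θ) (extend P)| ≤
      eigenvalueAccuracy r k m β ε) (Q : h → Pauli) :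
    |potentialEstimator H a h Q - θ h Q| ≤ ε := by
  set η := eigenvalueAccuracy r k m β ε with hη
  set c := ((4 : ℝ) ^ k)⁻¹ * Real.exp (-(β * (m - 1) / 2)) with hc
  have hc0 : 0 < c := by positivity
  have hmin : ∀ Q', c ≤ marginalOf (eigenvalue (gibbs H θ)) (region H h) Q' := by
    intro Q'
    refine le_trans ?_ (marginalOf_gibbs_ge hβ _ Q')
    have h1 : (4 * (H.filter fun h' => ¬ Disjoint h' (region H h)).card + 1 : ℝ) ≤ m := by
      exact_mod_cast hm
    refine mul_le_mul ?_ (Real.exp_le_exp.2 ?_) (Real.exp_pos _).le (by positivity)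
    · exact inv_anti₀ (by positivity) (pow_le_pow_right₀ (by norm_num) hk)
    · nlinarith
  rw [← potentialEstimator_eigenvalue hθ hh Q]
  have hlog := fun Q' => abs_log_sub_log_le hc0 (hmin Q') (abs_marginalOf_sub_le ha Q')
    (two_mul_eigenvalueAccuracy_le r k m β ε)
  refine (abs_potentialEstimator_sub_le hlog Q).trans ?_
  have h2 : 2 * η / c = min ε 1 / 4 ^ r := by
    rw [hη, eigenvalueAccuracy, ← hc]
    field_simp
  rw [h2]
  calc (4 : ℝ) ^ h.card * (min ε 1 / 4 ^ r) ≤ 4 ^ r * (min ε 1 / 4 ^ r) := by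
        gcongr
        norm_num
    _ = min ε 1 := by field_simp
    _ ≤ ε := min_le_left _ _

/-! ### The number of runs -/

/-- The query rate without its dependence on `p₀`. -/
noncomputable def baseRate (n m : ℕ) (β ε δ C : ℝ) : ℝ :=
  Real.exp (β * m) * 4 ^ (6 * m) / (ε * C) ^ 2 * Real.log ((n : ℝ) ^ m / δ)

theorem queryRate_eq (n r D : ℕ) (β ε δ C p₀ : ℝ) :
    queryRate n r D β ε δ C p₀ =
      max 1 (Real.log (1 / (1 - p₀))) * baseRate n (r * D ^ (r + 1)) β ε δ C := by
  rw [queryRate, baseRate, mul_assoc]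

theorem sq_le_two_mul_exp {β : ℝ} (hβ : 0 ≤ β) : β ^ 2 ≤ 2 * Real.exp β := by
  have := Real.quadratic_le_exp_of_nonneg hβ
  linarith

theorem half_le_log_pow_div {n m : ℕ} {δ : ℝ} (hn : 2 ≤ n) (hm : 1 ≤ m) (hδ : 0 < δ)
    (hδ1 : δ < 1) : 1 / 2 ≤ Real.log ((n : ℝ) ^ m / δ) := by
  have h2 : (2 : ℝ) ≤ (n : ℝ) ^ m / δ := by
    rw [le_div_iff₀ hδ]
    have h3 : (2 : ℝ) ≤ n := by exact_mod_cast hn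
    have h4 : (n : ℝ) ≤ (n : ℝ) ^ m := le_self_pow₀ (by linarith) (by omega)
    linarith
  have h5 := Real.log_le_log (by norm_num) h2
  linarith [Real.log_two_gt_d9]

/-- A rate of at least `1` absorbs the rounding of the number of runs to an integer. It relies on `ε
< β`, through `(ε C)² ≤ β² ≤ 2 exp β`. -/
theorem one_le_baseRate {n m : ℕ} {β ε δ C : ℝ} (hn : 2 ≤ n) (hm : 1 ≤ m) (hδ : 0 < δ)
    (hδ1 : δ < 1) (hε : 0 < ε) (hεβ : ε < β) (hC : 0 < C) (hC1 : C ≤ 1) :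
    1 ≤ baseRate n m β ε δ C := by
  have hΛ := half_le_log_pow_div hn hm hδ hδ1
  have h1 : (ε * C) ^ 2 ≤ 2 * Real.exp (β * m) := by
    have h2 : (ε * C) ^ 2 ≤ β ^ 2 := by
      have : ε * C ≤ β := (mul_le_of_le_one_right hε.le hC1).trans hεβ.le
      exact pow_le_pow_left₀ (by positivity) this 2
    have h3 : Real.exp β ≤ Real.exp (β * m) := by
      refine Real.exp_le_exp.2 (le_mul_of_one_le_right (by linarith) ?_)
      exact_mod_cast hm
    linarith [sq_le_two_mul_exp (hε.trans hεβ).le]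
  have h4 : (4 : ℝ) ≤ 4 ^ (6 * m) := le_self_pow₀ (by norm_num) (by omega)
  have h5 : 2 ≤ Real.exp (β * m) * 4 ^ (6 * m) / (ε * C) ^ 2 := by
    rw [le_div_iff₀ (by positivity)]
    nlinarith [Real.exp_pos (β * m)]
  rw [baseRate]
  nlinarith

/-- With `X = n^m`, each of the three factors `c`, `4^k`, `4` of the union bound is at most `X`,
which the cube `(δ / X)^3` cancels. -/
theorem exp_neg_three_mul_log_le {n m k c : ℕ} {δ : ℝ} (hn : 2 ≤ n) (hm : 2 ≤ m) (hk : 2 * k ≤ m)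
    (hc : c ≤ n ^ m) (hδ : 0 < δ) (hδ1 : δ < 1) :
    c * 4 ^ k * (4 * Real.exp (-(3 * Real.log ((n : ℝ) ^ m / δ)))) ≤ δ := by
  have hn' : (2 : ℝ) ≤ n := by exact_mod_cast hn
  have hpow : ∀ j : ℕ, 2 * j ≤ m → (4 : ℝ) ^ j ≤ (n : ℝ) ^ m := fun j hj => by
    calc (4 : ℝ) ^ j = 2 ^ (2 * j) := by rw [pow_mul]; norm_num
      _ ≤ (n : ℝ) ^ (2 * j) := pow_le_pow_left₀ (by norm_num) hn' _
      _ ≤ (n : ℝ) ^ m := pow_le_pow_right₀ (by linarith) hj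
  have h4 : (4 : ℝ) ≤ (n : ℝ) ^ m := by simpa using hpow 1 (by omega)
  have hc' : (c : ℝ) ≤ (n : ℝ) ^ m := by exact_mod_cast hc
  set X := (n : ℝ) ^ m with hX
  have hX0 : 0 < X := by linarith
  have hexp : Real.exp (-(3 * Real.log (X / δ))) = (δ / X) ^ 3 := by
    rw [← mul_neg, ← Real.log_inv, inv_div, show (3 : ℝ) = (3 : ℕ) by norm_num, Real.exp_nat_mul,
      Real.exp_log (by positivity)]
  rw [hexp]
  calc c * 4 ^ k * (4 * (δ / X) ^ 3) ≤ X * X * (X * (δ / X) ^ 3) := by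
        gcongr
        exact hpow k hk
    _ = δ ^ 3 := by field_simp
    _ ≤ δ := pow_le_of_le_one hδ.le hδ1.le (by norm_num)

theorem three_mul_log_le {n r k m N : ℕ} {β ε δ C : ℝ} (hm : 1 ≤ m) (hn : 2 ≤ n)
    (hrk : 2 * k + r ≤ 3 * m) (hδ : 0 < δ) (hδ1 : δ < 1) (hε : 0 < ε) (hεβ : ε < β) (hC : 0 < C)
    (hN : 3072 * baseRate n m β ε δ C ≤ N) :
    3 * Real.log ((n : ℝ) ^ m / δ) ≤
      N * (C * eigenvalueAccuracy r k m β ε / 4) ^ 2 / (8 * (3 ^ k) ^ 2) := by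
  have hΛ := half_le_log_pow_div hn hm hδ hδ1
  set Λ := Real.log ((n : ℝ) ^ m / δ) with hΛdef
  have hβ : 0 < β := hε.trans hεβ
  -- For `ε > 1` the rate divides by `ε²` although the accuracy is capped at `1`; the spare factor
  -- `exp β` pays for it because `ε < β`.
  have hκ : ε ^ 2 ≤ 2 * (min ε 1 ^ 2 * Real.exp β) := by
    rcases le_total ε 1 with h1 | h1
    · rw [min_eq_left h1]
      nlinarith [Real.one_le_exp hβ.le, sq_nonneg ε]
    · rw [min_eq_right h1, one_pow, one_mul]
      exact (pow_le_pow_left₀ hε.le hεβ.le 2).trans (sq_le_two_mul_exp hβ.le)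
  have hpow : (4 : ℝ) ^ (2 * k) * 4 ^ (2 * r) * (3 ^ k) ^ 2 ≤ 4 ^ (6 * m) := by
    have h9 : ((3 : ℝ) ^ k) ^ 2 ≤ 4 ^ (2 * k) := by
      rw [← pow_mul, mul_comm k 2]
      exact pow_le_pow_left₀ (by norm_num) (by norm_num) _
    calc (4 : ℝ) ^ (2 * k) * 4 ^ (2 * r) * (3 ^ k) ^ 2
        ≤ 4 ^ (2 * k) * 4 ^ (2 * r) * 4 ^ (2 * k) := by gcongr
      _ = 4 ^ (2 * k + 2 * r + 2 * k) := by rw [pow_add, pow_add]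
      _ ≤ 4 ^ (6 * m) := pow_le_pow_right₀ (by norm_num) (by omega)
  have hexp : Real.exp (-(β * (m - 1) / 2)) ^ 2 * Real.exp (β * m) = Real.exp β := by
    rw [← Real.exp_nat_mul, ← Real.exp_add]
    congr 1
    push_cast
    ring
  -- `3072 = 3 * 2 * 8 * 64`: the target `3`, the `2` of `hκ`, the `8` of Hoeffding's bound, and `(4
  -- * 2)²` from the tolerance `C η / 4` and the `2` in the accuracy.
  have hval : 3072 * baseRate n m β ε δ C * (C * eigenvalueAccuracy r k m β ε / 4) ^ 2 /
      (8 * (3 ^ k) ^ 2) = 3 * Λ * ((4 ^ (6 * m) / (4 ^ (2 * k) * 4 ^ (2 * r) * (3 ^ k) ^ 2)) *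
        (2 * (min ε 1 ^ 2 * Real.exp β) / ε ^ 2)) := by
    rw [baseRate, eigenvalueAccuracy, ← hexp, ← hΛdef, pow_mul' (4 : ℝ) 2 k, pow_mul' (4 : ℝ) 2 r]
    field_simp
    ring
  calc 3 * Λ ≤ 3 * Λ * ((4 ^ (6 * m) / (4 ^ (2 * k) * 4 ^ (2 * r) * (3 ^ k) ^ 2)) *
        (2 * (min ε 1 ^ 2 * Real.exp β) / ε ^ 2)) := by
        refine le_mul_of_one_le_right (by linarith) (one_le_mul_of_one_le_of_one_le ?_ ?_)
        · exact (one_le_div (by positivity)).2 hpow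
        · exact (one_le_div (by positivity)).2 hκ
    _ = 3072 * baseRate n m β ε δ C * (C * eigenvalueAccuracy r k m β ε / 4) ^ 2 /
      (8 * (3 ^ k) ^ 2) := hval.symm
    _ ≤ _ := by gcongr

end Protocols

end PauliLearning

/-! ### The main theorem -/

open PauliLearning
theorem mainTheorem2 :
    ∃ (K : ℝ) (T : ℕ → ℕ → ℕ), 0 < K ∧
      ∀ (n r D : ℕ) (β ε δ Cspam : ℝ) (H : Finset (Finset (Fin n))),
        2 ≤ n → 1 ≤ r → 5 ≤ D → 0 < β → 0 < ε → 0 < δ → δ < 1 → 0 < Cspam →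
        (∀ h ∈ H, h.Nonempty ∧ h.card ≤ r) →
        (∀ u : Fin n, ((interactionGraph H).neighborSet u).ncard ≤ D) →
        -- run time of the classical post-processing: one call per hyperedge
        (H.card : ℝ) ≤ K * (n : ℝ) ^ (r * D ^ (r + 1)) ∧
        (∀ h ∈ H, EstimatorRunsIn H h (T r D)) ∧
        -- the protocol knows only the hypergraph and the parameters
        ∃ A : Protocol n,
          ∀ (θ : Potentials n) (Φ₁ Φ₂ : Op n →ₗ[ℂ] Op n),
            Normalized H θ → (∀ h ∈ H, ∀ Q, |θ h Q| ≤ β) →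
            IsChannel Φ₁ → IsChannel Φ₂ →
            (∀ h ∈ H, ∀ P : region H h → Pauli, Cspam ≤ spamFactor Φ₁ Φ₂ (extend P)) →
            (A.queries : ℝ) ≤ K * queryRate n r D β ε δ Cspam (gibbs H θ (idString n)) ∧
            (A.runs : ℝ) ≤ K * queryRate n r D β ε δ Cspam (gibbs H θ (idString n)) ∧
            (∀ j, (A.uses j : ℝ) ≤
              K * max 1 (Real.log (1 / (1 - gibbs H θ (idString n))))) ∧
            1 - δ ≤ A.prob (gibbs H θ) Φ₁ Φ₂ (fun data =>
              ∀ h ∈ H, ∀ Q : h → Pauli,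
                |potentialEstimator H (A.eigenvalues data) h Q - θ h Q| ≤ ε) := by
  refine ⟨10000, fun r D => estimatorSteps (r * D), by norm_num, ?_⟩
  intro n r D β ε δ C H hn hr hD hβ hε hδ hδ1 hC hH hdeg
  have hdeg' : ∀ v, (neighbours H v).card ≤ D := fun v => (card_neighbours v).trans_le (hdeg v)
  have hk : ∀ h ∈ H, (region H h).card ≤ r * D := fun h hh =>
    card_region_le (by omega) hH hdeg' hh
  set m := r * D ^ (r + 1) with hmdef
  have hDpow : D * 5 ≤ D ^ (r + 1) := by
    calc D * 5 ≤ D * D := Nat.mul_le_mul_left _ hD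
      _ = D ^ 2 := by ring
      _ ≤ D ^ (r + 1) := Nat.pow_le_pow_right (by omega) (by omega)
  have hkm : 5 * (r * D) ≤ m := by
    calc 5 * (r * D) = r * (D * 5) := by ring
      _ ≤ m := Nat.mul_le_mul_left _ hDpow
  have hrD : r ≤ r * D := Nat.le_mul_of_pos_right _ (by omega)
  have hHm : H.card ≤ n ^ m :=
    (card_hypergraph_le hH).trans (Nat.pow_le_pow_right (by omega) (by omega))
  refine ⟨?_, fun h hh => estimatorRunsIn H h (hk h hh), ?_⟩
  · have h1 : (H.card : ℝ) ≤ (n : ℝ) ^ m := by exact_mod_cast hHm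
    have h2 : (0 : ℝ) ≤ (n : ℝ) ^ m := by positivity
    linarith
  have hmax : ∀ p : ℝ, 1 ≤ max 1 (Real.log (1 / (1 - p))) := fun p => le_max_left _ _
  -- In the complementary case no data are needed, and the rate may be too small to allow even one
  -- run.
  by_cases hcase : ε < β ∧ C ≤ 1
  · obtain ⟨hεβ, hC1⟩ := hcase
    have hB := one_le_baseRate hn (by omega : 1 ≤ m) hδ hδ1 hε hεβ hC hC1
    set B := baseRate n m β ε δ C with hBdef
    obtain ⟨N, hN⟩ : ∃ N, N = ⌈3072 * B⌉₊ := ⟨_, rfl⟩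
    have hN1 : 3072 * B ≤ N := hN ▸ Nat.le_ceil _
    have hN2 : (N : ℝ) < 3072 * B + 1 := hN ▸ Nat.ceil_lt_add_one (by linarith)
    have hN0 : 0 < N := by
      have : (0 : ℝ) < N := by linarith
      exact_mod_cast this
    refine ⟨ratioProtocol n N, fun θ Φ₁ Φ₂ hθ hθβ hΦ₁ hΦ₂ hspam => ?_⟩
    -- `2N ≤ 6144 * B + 2`, and `B ≥ 1` leaves room below `10000 * B`.
    have hrate : 2 * (N : ℝ) ≤ 10000 * queryRate n r D β ε δ C (gibbs H θ (idString n)) := by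
      rw [queryRate_eq, ← hBdef]
      nlinarith [hmax (gibbs H θ (idString n))]
    refine ⟨?_, ?_, fun j => ?_, ?_⟩
    · rw [queries_ratioProtocol]
      linarith [Nat.cast_nonneg (α := ℝ) N]
    · change ((N + N : ℕ) : ℝ) ≤ _
      push_cast
      linarith
    · have h1 : ((ratioProtocol n N).uses j : ℝ) ≤ 1 := by
        have : (ratioProtocol n N).uses j ≤ 1 := by
          simp only [ratioProtocol]
          split_ifs <;> omega
        exact_mod_cast this
      linarith [hmax (gibbs H θ (idString n))]
    · have hη := eigenvalueAccuracy_pos r (r * D) m β hε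
      have hη1 : eigenvalueAccuracy r (r * D) m β ε ≤ 1 := by
        have h1 := two_mul_eigenvalueAccuracy_le r (r * D) m β ε
        have h2 : ((4 : ℝ) ^ (r * D))⁻¹ ≤ 1 := inv_le_one_of_one_le₀ (one_le_pow₀ (by norm_num))
        have h3 : Real.exp (-(β * (m - 1) / 2)) ≤ 1 := by
          have h4 : (1 : ℝ) ≤ m := by exact_mod_cast (by omega : 1 ≤ m)
          refine Real.exp_le_one_iff.2 ?_
          nlinarith
        have h5 := mul_le_one₀ h2 (Real.exp_pos _).le h3
        linarith
      refine le_trans ?_ (prob_ratioProtocol_ge (fun P => (gibbs_pos H θ P).le) (sum_gibbs H θ)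
        hΦ₁ hΦ₂ hC hη hη1 hspam hk hN0 fun data hdata h hh Q =>
          abs_potentialEstimator_sub_potential_le hβ hε hθ hθβ hh (hH h hh).2 (hk h hh)
            (four_mul_card_touching_region_lt hr hD hH hdeg' hh) (hdata h hh) Q)
      have h1 := three_mul_log_le (r := r) (k := r * D) (by omega : 1 ≤ m) hn (by omega) hδ hδ1 hε
        hεβ hC hN1
      have h2 := exp_neg_three_mul_log_le (k := r * D) hn (by omega : 2 ≤ m) (by omega) hHm hδ hδ1
      refine sub_le_sub_left (le_trans ?_ h2) 1
      gcongr
  · refine ⟨depolarizingProtocol H, fun θ Φ₁ Φ₂ hθ hθβ hΦ₁ hΦ₂ hspam => ?_⟩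
    have hrate : 0 ≤ 10000 * queryRate n r D β ε δ C (gibbs H θ (idString n)) := by
      have hΛ := half_le_log_pow_div hn (by omega : 1 ≤ m) hδ hδ1
      rw [queryRate_eq, baseRate]
      have h1 := hmax (gibbs H θ (idString n))
      have h2 : 0 ≤ Real.log ((n : ℝ) ^ (r * D ^ (r + 1)) / δ) := by linarith
      positivity
    refine ⟨?_, ?_, fun j => Fin.elim0 j, ?_⟩
    · simpa [Protocol.queries, depolarizingProtocol] using hrate
    · simpa [depolarizingProtocol] using hrate
    · rw [prob_depolarizingProtocol]
      · linarith
      · intro data h hh Q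
        -- The protocol returns the eigenvalues of the Gibbs distribution with zero potentials, at
        -- which the estimator is exact.
        have h1 : potentialEstimator H ((depolarizingProtocol H).eigenvalues data) h Q = 0 :=
          potentialEstimator_eigenvalue (normalized_zero H) hh Q
        -- The hyperedge `h` at hand makes the SPAM hypothesis at the identity string available, so
        -- the failure of `hcase` must come from `β ≤ ε`.
        have hC1 : C ≤ 1 := by
          have h2 := hspam h hh fun _ => .I
          have h3 : extend (fun _ : region H h => Pauli.I) = idString n := by
            funext i
            simp [extend, idString]
          rwa [h3, spamFactor_idString hΦ₁ hΦ₂] at h2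
        have hβε : β ≤ ε := not_lt.1 fun h2 => hcase ⟨h2, hC1⟩
        rw [h1, zero_sub, abs_neg]
        exact (hθβ h hh Q).trans hβε
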